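/- **Generalised Steiner Theorem.** Let $\mathbb{M}=\mathbb{R}^4$ be Minkowski space with metric $\eta=\mathrm{diag}(1,-1,-1,-1)$, and let $S$ be a smooth space-like two-sphere in $\mathbb{M}$, given by a smooth space-like immersion $x:S^2\to\mathbb{M}$ (in particular $x$ may be an embedding). Let $\ell^a$ be a smooth field of future-pointing null normals along $S$ (for instance the outgoing one), and let $dA$ be the area element induced on $S$. With $m^a=(e_0^a+ie_1^a)/\sqrt2$, where $(e_0,e_1)$ is an orthonormal frame tangent to $S$, put $$\rho_0=m^a\bar m^b\nabla_b\ell_a\in\mathbb{R},\qquad \sigma_0=m^am^b\nabla_b\ell_a .$$ Let $t^a$ be a constant vector with $t^at_a=1$. The null hypersurface generated by the normals $\ell^a$ consists of the points $x^a(p)+s\,\ell^a(p)$, $p\in S^2$; rescale the affine parameter $s$ to $\hat s=s\,t^a\ell_a$. Let $A(\hat s)$ be the area of the cross-section $\hat s=\mathrm{const}$, i.e. of the map $p\mapsto x^a(p)+\frac{\hat s}{t^b\ell_b(p)}\,\ell^a(p)$, computed with the area element of the induced metric (so with multiplicity if the cross-section meets itself), let $A_0=A(0)$ be the area of $S$,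 and let $$\hat M=-\int_S\frac{\rho_0}{t^a\ell_a}\,dA .$$ 1. If $\hat s\in\mathbb{R}$ is such that no caustic occurs strictly between $0$ and $\hat s$, i.e. the cross-section at $\tau$ is a space-like immersion for every $\tau$ strictly between $0$ and $\hat s$, then $$A(\hat s)=A_0+2\hat s\,\hat M+4\pi\hat s^2 .$$ 2. If $S$ is future convex, i.e. $\rho_0<0$ and $\rho_0^2-\sigma_0\bar\sigma_0>0$ everywhere on $S$, and $t^a$ is future-pointing, then the same formula holds for every $\hat s\ge 0$. -/

import Mathlib

open scoped Manifold ContDiff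

noncomputable section

namespace Minkowski

/-- Minkowski space `𝕄 = ℝ⁴`, with coordinates `(x⁰, x¹, x², x³)`. -/
abbrev Mink : Type := Fin 4 → ℝ

/-- The Minkowski metric of signature `(+,-,-,-)`; for `R = ℝ` on `𝕄`, and for `R = ℂ` its
complex-bilinear extension to `𝕄 ⊗ ℂ`. -/
def eta {R : Type*} [CommRing R] (v w : Fin 4 → R) : R :=
  v 0 * w 0 - v 1 * w 1 - v 2 * w 2 - v 3 * w 3

/-- The unit sphere `S²`, with Mathlib's manifold structure; it is the parameter manifold of the
two-surfaces below. -/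
abbrev Sph : Type := Metric.sphere (0 : EuclideanSpace ℝ (Fin 3)) 1

/-- The derivative of a map `f : S² → 𝕄` at `p`. -/
def deriv₂ (f : Sph → Mink) (p : Sph) : TangentSpace (𝓡 2) p →L[ℝ] Mink :=
  mfderiv (𝓡 2) 𝓘(ℝ, Mink) f p

/-- The derivative of the inclusion `S² → ℝ³` at `p`. -/
def derivIncl (p : Sph) : TangentSpace (𝓡 2) p →L[ℝ] EuclideanSpace ℝ (Fin 3) :=
  mfderiv (𝓡 2) 𝓘(ℝ, EuclideanSpace ℝ (Fin 3)) (fun q : Sph => (q : EuclideanSpace ℝ (Fin 3))) p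

/-- A basis of the tangent space of `S²` at `p` (the coordinate basis of Mathlib's model). -/
def tangentBasis (p : Sph) (i : Fin 2) : TangentSpace (𝓡 2) p :=
  (EuclideanSpace.single i (1 : ℝ) : EuclideanSpace ℝ (Fin 2))

/-- The metric induced by `f` (in the signature `(+,-,-,-)`) is negative definite, i.e. `f` is a
space-like immersion. -/
def IsSpacelike (f : Sph → Mink) : Prop :=
  ∀ (p : Sph) (v : TangentSpace (𝓡 2) p), v ≠ 0 → eta (deriv₂ f p v) (deriv₂ f p v) < 0

/-- A space-like two-sphere `S` in Minkowski space, given by a smooth map `x : S² → 𝕄`. -/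
structure IsSpacelikeSphere (x : Sph → Mink) : Prop where
  smooth : ContMDiff (𝓡 2) 𝓘(ℝ, Mink) ∞ x
  spacelike : IsSpacelike x

/-- `ℓ` is a smooth field of future-pointing null normals along the surface `x`. -/
structure IsNullNormal (x l : Sph → Mink) : Prop where
  smooth : ContMDiff (𝓡 2) 𝓘(ℝ, Mink) ∞ l
  null : ∀ p, eta (l p) (l p) = 0
  future : ∀ p, 0 < l p 0
  normal : ∀ (p : Sph) (v : TangentSpace (𝓡 2) p), eta (l p) (deriv₂ x p v) = 0

/-- The density of the area element of the metric `-f^*η` with respect to the area element of the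
round unit sphere. The quotient of the two Gram determinants does not depend on the basis. -/
def areaDensity (f : Sph → Mink) (p : Sph) : ℝ :=
  √((Matrix.of fun i j : Fin 2 =>
        -eta (deriv₂ f p (tangentBasis p i)) (deriv₂ f p (tangentBasis p j))).det /
    (Matrix.of fun i j : Fin 2 =>
        inner ℝ (derivIncl p (tangentBasis p i)) (derivIncl p (tangentBasis p j))).det)

/-- The standard area measure of the round unit sphere, of total mass `4π`. -/
def roundMeasure : MeasureTheory.Measure Sph :=
  (MeasureTheory.volume : MeasureTheory.Measure (EuclideanSpace ℝ (Fin 3))).toSphere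

/-- `∫_S g dA` for the surface `S` parametrised by `f`, with `dA` the induced area element. -/
def surfaceIntegral (f : Sph → Mink) (g : Sph → ℝ) : ℝ :=
  ∫ p, g p * areaDensity f p ∂roundMeasure

/-- The area of the surface parametrised by `f`. -/
def area (f : Sph → Mink) : ℝ := surfaceIntegral f fun _ => 1

/-- The null geodesic generator through `x p` in the direction `ℓ p`, as a function of the affine
parameter `s` with `s = 0` on `S` and `Ds = 1`. -/
def generator (x l : Sph → Mink) (p : Sph) (s : ℝ) : Mink := x p + s • l p

/-- The cross-section `ŝ = const` of the null hypersurface, where `ŝ = s tᵃℓₐ`. -/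
def crossSection (x l : Sph → Mink) (t : Mink) (shat : ℝ) (p : Sph) : Mink :=
  generator x l p (shat / eta t (l p))

/-- At each point, a pair of tangent vectors that is orthonormal for the induced metric `-x^*η`.
No continuity in the point is asked for. -/
def IsOrthonormalFrame (x : Sph → Mink) (e : ∀ p : Sph, Fin 2 → TangentSpace (𝓡 2) p) : Prop :=
  ∀ (p : Sph) (i j : Fin 2),
    eta (deriv₂ x p (e p i)) (deriv₂ x p (e p j)) = if i = j then -1 else 0

/-- `(a + i b)/√2` in `𝕄 ⊗ ℂ`. -/
def complexVector (a b : Mink) : Fin 4 → ℂ :=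
  fun k => ((a k : ℂ) + Complex.I * (b k : ℂ)) / ((√2 : ℝ) : ℂ)

variable (x l : Sph → Mink) (e : ∀ p : Sph, Fin 2 → TangentSpace (𝓡 2) p) (p : Sph)

/-- The complex null tangent vector `m = (e₀ + i e₁)/√2`. -/
def mVec : Fin 4 → ℂ := complexVector (deriv₂ x p (e p 0)) (deriv₂ x p (e p 1))

/-- `δℓ = mᵇ∇_b ℓ`. -/
def deltaL : Fin 4 → ℂ := complexVector (deriv₂ l p (e p 0)) (deriv₂ l p (e p 1))

/-- `δ̄ℓ = m̄ᵇ∇_b ℓ`. -/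
def deltaBarL : Fin 4 → ℂ := complexVector (deriv₂ l p (e p 0)) (-deriv₂ l p (e p 1))

/-- The spin coefficient `ρ = mᵃ m̄ᵇ∇_b ℓ_a`. It is real, because `ℓ` is normal to a surface, and
does not depend on the frame; the real part only fixes the type. -/
def rho : ℝ := (eta (mVec x e p) (deltaBarL l e p)).re

/-- The spin coefficient `σ = mᵃ mᵇ∇_b ℓ_a`. A rotation of the frame multiplies it by a phase. -/
def sigma : ℂ := eta (mVec x e p) (deltaL l e p)

/-- `S` is future convex (with respect to the null normal `ℓ`): `ρ < 0` and `ρ² - σσ̄ > 0`. -/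
def FutureConvex : Prop :=
  ∀ p : Sph, rho x l e p < 0 ∧ 0 < rho x l e p ^ 2 - ‖sigma x l e p‖ ^ 2

/-- `M̂ = -∫_S ρ₀ / (tᵃℓₐ) dA`. -/
def mHat (t : Mink) : ℝ :=
  -surfaceIntegral x fun p => rho x l e p / eta t (l p)

end Minkowski

end

/-!
The area of the cross-section `ŝ = s` is a quadratic polynomial in `s` because the generators of
the null hypersurface are straight lines. Rescale the null normal to `n = l / eta t l`, so that the
cross-section is `x + s n`. Its tangent vectors all lie in `n^⊥`, on which `eta` degenerates exactly
along `n`. Hence they can be read modulo `n` in the Euclidean plane orthogonal to `n` and `t` without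
changing the induced metric (`shadow_dotProduct_shadow`). In this plane the area density is the
absolute value of a determinant of the form `det (α + s ν)`, where `α` is the tangent map of `S`
and `ν` is the derivative of the Gauss map `N`, the projection of `n` to the unit sphere of `t^⊥`
(`areaDensity_crossSection`, `areaDet_eq`). The coefficient of `s` is `-2 ρ / eta t l` times the
density of `S`, which gives the mass term, and the coefficient of `s²` is the Jacobian of `N`.

The integral of the Jacobian is `±4π` whatever the immersion: `α` is an isomorphism from the tangent
bundle of the sphere to its pull-back by `N`, so twice the degree of `N` is, up to orientation, the
Euler number `2` of the sphere (`integral_jacobian_gaussMap`, `integral_gaussDet`). The proof is by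
Stokes' theorem on the rectangle of spherical coordinates. The frame vector is the conformal part of
`α` applied to the coordinate direction of the colatitude, which is smooth up to the sides of the
rectangle that represent the poles. Its connection form has exterior derivative minus the area form
(`structure_equation`). On the polar sides the frame turns at the constant rate of the coordinate
frame, because the conformal part commutes with rotations, and this gives the total `±4π`.

The sign is that of `det α`, so it drops out together with the absolute value as long as the
determinant has not changed sign. A determinant that does change sign vanishes
somewhere before, which is a caustic (`areaDet_ne_zero`). For a future convex surface all
coefficients of the polynomial have the same sign (`rho_sq_sub_sigma_sq_le`).

Smoothness on the sphere is handled by extending maps to be constant along rays of `ℝ³` (`homExt`),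
so that tangent maps become ordinary derivatives.
-/

open Matrix

noncomputable section

namespace Minkowski

/-! ### Algebra in Euclidean three-space -/

/-- The determinant of three vectors of `ℝ³`. -/
def triple (u v w : Fin 3 → ℝ) : ℝ :=
  u 0 * (v 1 * w 2 - v 2 * w 1) - u 1 * (v 0 * w 2 - v 2 * w 0) + u 2 * (v 0 * w 1 - v 1 * w 0)

/-- The product of two determinants is the determinant of the matrix of inner products. -/
lemma triple_mul_triple (a b c d e f : Fin 3 → ℝ) :
    triple a b c * triple d e f =
      (a ⬝ᵥ d) * ((b ⬝ᵥ e) * (c ⬝ᵥ f) - (b ⬝ᵥ f) * (c ⬝ᵥ e)) -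
      (a ⬝ᵥ e) * ((b ⬝ᵥ d) * (c ⬝ᵥ f) - (b ⬝ᵥ f) * (c ⬝ᵥ d)) +
      (a ⬝ᵥ f) * ((b ⬝ᵥ d) * (c ⬝ᵥ e) - (b ⬝ᵥ e) * (c ⬝ᵥ d)) := by
  simp only [triple, dotProduct, Fin.sum_univ_three]
  ring

lemma triple_sq_of_unit_normal {N v w : Fin 3 → ℝ} (hN : N ⬝ᵥ N = 1) (hv : v ⬝ᵥ N = 0)
    (hw : w ⬝ᵥ N = 0) :
    triple N v w ^ 2 = (v ⬝ᵥ v) * (w ⬝ᵥ w) - (v ⬝ᵥ w) * (w ⬝ᵥ v) := by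
  rw [sq, triple_mul_triple, hN, hv, hw, dotProduct_comm N v, dotProduct_comm N w, hv, hw]
  ring

lemma triple_add_smul (N u v c d : Fin 3 → ℝ) (s : ℝ) :
    triple N (u + s • c) (v + s • d) =
      triple N u v + s * (triple N u d + triple N c v) + s ^ 2 * triple N c d := by
  simp only [triple, Pi.add_apply, Pi.smul_apply, smul_eq_mul]; ring

/-- With `h i j = u i ⬝ᵥ c j`, the first-order term of the determinant of `1 + s h` is the trace. -/
lemma triple_trace {N u₀ u₁ c₀ c₁ : Fin 3 → ℝ} (hN : N ⬝ᵥ N = 1) (hu₀ : u₀ ⬝ᵥ N = 0)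
    (hu₁ : u₁ ⬝ᵥ N = 0) (hc₀ : c₀ ⬝ᵥ N = 0) (hc₁ : c₁ ⬝ᵥ N = 0) (h₀₀ : u₀ ⬝ᵥ u₀ = 1)
    (h₁₁ : u₁ ⬝ᵥ u₁ = 1) (h₀₁ : u₀ ⬝ᵥ u₁ = 0) :
    triple N u₀ c₁ + triple N c₀ u₁ = (u₀ ⬝ᵥ c₀ + u₁ ⬝ᵥ c₁) * triple N u₀ u₁ := by
  have hsq : triple N u₀ u₁ ^ 2 = 1 := by
    rw [triple_sq_of_unit_normal hN hu₀ hu₁, h₀₀, h₁₁, h₀₁]; simp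
  have e₁ := triple_mul_triple N u₀ c₁ N u₀ u₁
  have e₂ := triple_mul_triple N c₀ u₁ N u₀ u₁
  rw [dotProduct_comm u₁ u₀] at e₂
  simp only [hN, hu₀, hu₁, hc₀, hc₁, h₀₀, h₁₁, h₀₁, dotProduct_comm c₀ u₀,
    dotProduct_comm c₁ u₁] at e₁ e₂
  linear_combination (triple N u₀ u₁) * (e₁ + e₂) - (triple N u₀ c₁ + triple N c₀ u₁) * hsq

/-- With `h i j = u i ⬝ᵥ c j`, the second-order term of the determinant of `1 + s h` is
`det h`. -/
lemma triple_det {N u₀ u₁ c₀ c₁ : Fin 3 → ℝ} (hN : N ⬝ᵥ N = 1) (hu₀ : u₀ ⬝ᵥ N = 0)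
    (hu₁ : u₁ ⬝ᵥ N = 0) (hc₀ : c₀ ⬝ᵥ N = 0) (hc₁ : c₁ ⬝ᵥ N = 0) (h₀₀ : u₀ ⬝ᵥ u₀ = 1)
    (h₁₁ : u₁ ⬝ᵥ u₁ = 1) (h₀₁ : u₀ ⬝ᵥ u₁ = 0) :
    triple N c₀ c₁ =
      ((u₀ ⬝ᵥ c₀) * (u₁ ⬝ᵥ c₁) - (u₀ ⬝ᵥ c₁) * (u₁ ⬝ᵥ c₀)) * triple N u₀ u₁ := by
  have hsq : triple N u₀ u₁ ^ 2 = 1 := by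
    rw [triple_sq_of_unit_normal hN hu₀ hu₁, h₀₀, h₁₁, h₀₁]; simp
  have e₁ := triple_mul_triple N c₀ c₁ N u₀ u₁
  simp only [hN, hc₀, hc₁, dotProduct_comm c₀ u₀,
    dotProduct_comm c₁ u₁, dotProduct_comm c₀ u₁, dotProduct_comm c₁ u₀] at e₁
  linear_combination (triple N u₀ u₁) * e₁ - triple N c₀ c₁ * hsq

/-- The parameter space `ℝ³` that contains the unit sphere. -/
abbrev E3 : Type := EuclideanSpace ℝ (Fin 3)

/-- The determinant of a linear map `ℝ³ → ℝ³`. -/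
def det3 (A : E3 →L[ℝ] (Fin 3 → ℝ)) : ℝ :=
  triple (A (EuclideanSpace.single 0 1)) (A (EuclideanSpace.single 1 1))
    (A (EuclideanSpace.single 2 1))

lemma E3_eq_sum (u : E3) : u = u 0 • EuclideanSpace.single 0 (1 : ℝ) +
    u 1 • EuclideanSpace.single 1 (1 : ℝ) + u 2 • EuclideanSpace.single 2 (1 : ℝ) := by
  ext i
  fin_cases i <;> simp

lemma triple_map (A : E3 →L[ℝ] (Fin 3 → ℝ)) (u v w : E3) :
    triple (A u) (A v) (A w) = det3 A * triple u v w := by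
  rw [E3_eq_sum u, E3_eq_sum v, E3_eq_sum w]
  simp only [map_add, map_smul, det3, triple, Pi.add_apply, Pi.smul_apply, smul_eq_mul]
  simp
  ring

lemma E3_inner_eq_dotProduct (u v : E3) : inner ℝ u v = (u : Fin 3 → ℝ) ⬝ᵥ v := by
  simp [dotProduct, Fin.sum_univ_three, PiLp.inner_apply, mul_comm]

/-! ### Splitting Minkowski space along a unit time-like vector -/

section Eta

variable (u v w : Mink) (c : ℝ)

lemma eta_add_right : eta u (v + w) = eta u v + eta u w := by
  simp only [eta, Pi.add_apply]; ring

lemma eta_smul_right : eta u (c • v) = c * eta u v := by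
  simp only [eta, Pi.smul_apply, smul_eq_mul]; ring

lemma eta_add_left : eta (u + v) w = eta u w + eta v w := by
  simp only [eta, Pi.add_apply]; ring

lemma eta_smul_left : eta (c • u) v = c * eta u v := by
  simp only [eta, Pi.smul_apply, smul_eq_mul]; ring

lemma eta_comm : eta u v = eta v u := by
  simp only [eta]; ring

end Eta

/-- `eta t` as a continuous linear functional. -/
def etaL (t : Mink) : Mink →L[ℝ] ℝ :=
  LinearMap.toContinuousLinearMap
    { toFun := eta t
      map_add' := eta_add_right t
      map_smul' := fun c v => by simp [eta_smul_right] }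

@[simp] lemma etaL_apply (t u : Mink) : etaL t u = eta t u := rfl

/-- The orthogonal complement of a unit time-like vector is a Euclidean three-space: `P` is the
projection onto it, read in an orthonormal basis. -/
lemma exists_spatial_projection {t : Mink} (ht : eta t t = 1) :
    ∃ P : Mink →L[ℝ] (Fin 3 → ℝ), ∀ u v, eta u v = eta t u * eta t v - P u ⬝ᵥ P v := by
  wlog h : 0 ≤ t 0 generalizing t
  · obtain ⟨P, hP⟩ := this (t := -t) (by simpa [eta] using ht) (by simp at h ⊢; exact h.le)
    refine ⟨P, fun u v => ?_⟩
    rw [hP u v]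
    simp [eta]; ring
  -- The restriction of the boost that takes `t` to the time axis.
  let P : Mink →ₗ[ℝ] (Fin 3 → ℝ) :=
    { toFun := fun u i => u i.succ +
        t i.succ * ((t 1 * u 1 + t 2 * u 2 + t 3 * u 3) / (1 + t 0) - u 0)
      map_add' := fun u v => by ext i; simp; ring
      map_smul' := fun c v => by ext i; simp; ring }
  refine ⟨LinearMap.toContinuousLinearMap P, fun u v => ?_⟩
  have h1 : 1 + t 0 ≠ 0 := by positivity
  have e : t 1 ^ 2 + t 2 ^ 2 + t 3 ^ 2 = (t 0 - 1) * (1 + t 0) := by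
    simp only [eta] at ht; linear_combination -ht
  obtain ⟨a, ha⟩ : ∃ a, a * (1 + t 0) = t 1 * u 1 + t 2 * u 2 + t 3 * u 3 :=
    ⟨_, div_mul_cancel₀ _ h1⟩
  obtain ⟨b, hb⟩ : ∃ b, b * (1 + t 0) = t 1 * v 1 + t 2 * v 2 + t 3 * v 3 :=
    ⟨_, div_mul_cancel₀ _ h1⟩
  simp only [eta, LinearMap.coe_toContinuousLinearMap', P, dotProduct, Fin.sum_univ_three,
    LinearMap.coe_mk, AddHom.coe_mk, ← ha, ← hb, mul_div_cancel_right₀ _ h1]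
  simp only [show Fin.succ (0 : Fin 3) = 1 from rfl, show Fin.succ (1 : Fin 3) = 2 from rfl,
    show Fin.succ (2 : Fin 3) = 3 from rfl]
  have ha' : t 1 * u 1 = a * (1 + t 0) - t 2 * u 2 - t 3 * u 3 := by linarith
  have hb' : t 1 * v 1 = b * (1 + t 0) - t 2 * v 2 - t 3 * v 3 := by linarith
  have k1 : t 0 * u 0 - t 1 * u 1 - t 2 * u 2 - t 3 * u 3 = t 0 * u 0 - a * (1 + t 0) := by
    linarith
  have k2 : t 0 * v 0 - t 1 * v 1 - t 2 * v 2 - t 3 * v 3 = t 0 * v 0 - b * (1 + t 0) := by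
    linarith
  rw [k1, k2]
  linear_combination (a - u 0) * (b - v 0) * e - (a - u 0) * hb - (b - v 0) * ha

/-! ### Maps on the sphere as homogeneous maps on space -/

/-- The radial projection `y ↦ y / ‖y‖` onto the unit sphere, with an arbitrary value at `0`. -/
def radial (y : E3) : Sph :=
  if h : y = 0 then ⟨EuclideanSpace.single 0 1, by simp⟩
  else ⟨‖y‖⁻¹ • y, by simp [norm_smul, h]⟩

lemma radial_of_ne {y : E3} (h : y ≠ 0) : (radial y : E3) = ‖y‖⁻¹ • y := by
  simp [radial, h]

lemma Sph.norm_eq (p : Sph) : ‖(p : E3)‖ = 1 := norm_eq_of_mem_sphere p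

lemma Sph.ne_zero (p : Sph) : (p : E3) ≠ 0 := ne_zero_of_mem_unit_sphere p

lemma radial_smul {c : ℝ} (hc : 0 < c) (p : Sph) : radial (c • (p : E3)) = p := by
  ext1
  rw [radial_of_ne (smul_ne_zero hc.ne' p.ne_zero), norm_smul, p.norm_eq, smul_smul]
  simp [abs_of_pos hc, hc.ne']

@[simp] lemma radial_coe (p : Sph) : radial (p : E3) = p := by
  simpa using radial_smul one_pos p

lemma fact_finrank_E3 : Fact (Module.finrank ℝ E3 = 2 + 1) :=
  ⟨finrank_euclideanSpace_fin⟩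

lemma contMDiff_coe_Sph : ContMDiff (𝓡 2) 𝓘(ℝ, E3) ∞ (fun q : Sph => (q : E3)) :=
  haveI := fact_finrank_E3
  contMDiff_coe_sphere (n := 2)

lemma contMDiffAt_radial {y : E3} (hy : y ≠ 0) : ContMDiffAt 𝓘(ℝ, E3) (𝓡 2) ∞ radial y := by
  let U : TopologicalSpace.Opens E3 := ⟨{0}ᶜ, isOpen_compl_singleton⟩
  have hval : ContMDiff 𝓘(ℝ, E3) 𝓘(ℝ, E3) ∞ (fun u : U => ‖(u : E3)‖⁻¹ • (u : E3)) := by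
    intro u
    have hu : (u : E3) ≠ 0 := u.2
    refine (contMDiffAt_subtype_iff (f := fun z : E3 => ‖z‖⁻¹ • z)).2 ?_
    exact (((contDiffAt_norm ℝ hu).inv (norm_ne_zero_iff.2 hu)).smul contDiffAt_id).contMDiffAt
  have hmem : ∀ u : U, ‖(u : E3)‖⁻¹ • (u : E3) ∈ Metric.sphere (0 : E3) 1 := fun u => by
    have hu : (u : E3) ≠ 0 := u.2
    simp [norm_smul, hu]
  have h : ContMDiff 𝓘(ℝ, E3) (𝓡 2) ∞
      (Set.codRestrict (fun u : U => ‖(u : E3)‖⁻¹ • (u : E3)) _ hmem : U → Sph) :=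
    have := fact_finrank_E3
    hval.codRestrict_sphere (n := 2) hmem
  have heq : (fun u : U => radial u) = Set.codRestrict _ _ hmem := by
    ext1 u
    ext1
    exact radial_of_ne u.2
  have key : ContMDiffAt 𝓘(ℝ, E3) (𝓡 2) ∞ (fun u : U => radial u) ⟨y, hy⟩ := by
    rw [heq]
    exact h ⟨y, hy⟩
  exact contMDiffAt_subtype_iff.1 key

/-- The extension of a map on the sphere to a map on space that is constant along rays. -/
def homExt (f : Sph → Mink) (y : E3) : Mink := f (radial y)

lemma contDiffAt_homExt {f : Sph → Mink} (hf : ContMDiff (𝓡 2) 𝓘(ℝ, Mink) ∞ f) {y : E3}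
    (hy : y ≠ 0) : ContDiffAt ℝ ∞ (homExt f) y :=
  ((hf (radial y)).comp y (contMDiffAt_radial hy)).contDiffAt

lemma fderiv_homExt_radial {f : Sph → Mink} {p : Sph} (h : DifferentiableAt ℝ (homExt f) p) :
    fderiv ℝ (homExt f) p p = 0 := by
  have h1 : HasDerivAt (fun c : ℝ => c • (p : E3)) ((1 : ℝ) • (p : E3)) 1 :=
    (hasDerivAt_id (1 : ℝ)).smul_const _
  have h0 : HasFDerivAt (homExt f) (fderiv ℝ (homExt f) p) ((1 : ℝ) • (p : E3)) := by
    simpa using h.hasFDerivAt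
  have h2 := h0.comp_hasDerivAt (1 : ℝ) h1
  have h3 : HasDerivAt (homExt f ∘ fun c : ℝ => c • (p : E3)) 0 1 := by
    refine (hasDerivAt_const (1 : ℝ) (f p)).congr_of_eventuallyEq ?_
    filter_upwards [lt_mem_nhds one_pos] with c hc
    simp [homExt, radial_smul hc]
  simpa using h2.unique h3

lemma deriv₂_eq_fderiv {f : Sph → Mink} {p : Sph} (h : DifferentiableAt ℝ (homExt f) p)
    (v : TangentSpace (𝓡 2) p) :
    deriv₂ f p v = fderiv ℝ (homExt f) p (derivIncl p v) := by
  have hf : f = homExt f ∘ (fun q : Sph => (q : E3)) := by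
    ext1 q; simp [homExt]
  have hi : MDifferentiableAt (𝓡 2) 𝓘(ℝ, E3) (fun q : Sph => (q : E3)) p :=
    (contMDiff_coe_Sph p).mdifferentiableAt (by simp)
  have hc := mfderiv_comp p (g := homExt f) h.mdifferentiableAt hi
  rw [← hf, mfderiv_eq_fderiv] at hc
  exact congrArg (fun L => L v) hc

lemma derivIncl_orthogonal (p : Sph) (v : TangentSpace (𝓡 2) p) :
    inner ℝ (p : E3) (derivIncl p v) = 0 := by
  have h : derivIncl p v ∈ (ℝ ∙ (p : E3))ᗮ := by
    have := fact_finrank_E3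
    rw [← range_mvfderiv_subtypeVal (n := 2) p]
    exact ⟨v, rfl⟩
  exact Submodule.mem_orthogonal_singleton_iff_inner_right.1 h

lemma exists_derivIncl_eq {p : Sph} {v : E3} (hv : inner ℝ (p : E3) v = 0) :
    ∃ v' : TangentSpace (𝓡 2) p, derivIncl p v' = v := by
  have h : v ∈ (ℝ ∙ (p : E3))ᗮ := Submodule.mem_orthogonal_singleton_iff_inner_right.2 hv
  have := fact_finrank_E3
  rw [← range_mvfderiv_subtypeVal (n := 2) p] at h
  exact h

lemma derivIncl_injective (p : Sph) : Function.Injective (derivIncl p) :=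
  haveI := fact_finrank_E3
  injective_mvfderiv_subtypeVal_sphere (n := 2) p

lemma Sph.dotProduct_self (p : Sph) : (p : E3).ofLp ⬝ᵥ (p : E3).ofLp = 1 := by
  rw [← E3_inner_eq_dotProduct, real_inner_self_eq_norm_sq, p.norm_eq, one_pow]

lemma derivIncl_dotProduct (p : Sph) (v : TangentSpace (𝓡 2) p) :
    (derivIncl p v).ofLp ⬝ᵥ (p : E3).ofLp = 0 := by
  rw [dotProduct_comm, ← E3_inner_eq_dotProduct, derivIncl_orthogonal]

lemma triple_tangentBasis_ne_zero (p : Sph) :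
    triple (p : E3) (derivIncl p (tangentBasis p 0)) (derivIncl p (tangentBasis p 1)) ≠ 0 := by
  intro h
  set j₀ := derivIncl p (tangentBasis p 0) with hj₀
  set j₁ := derivIncl p (tangentBasis p 1) with hj₁
  have hg := triple_sq_of_unit_normal p.dotProduct_self (derivIncl_dotProduct p _)
    (derivIncl_dotProduct p _) (v := j₀.ofLp) (w := j₁.ofLp)
  rw [h] at hg
  simp only [← E3_inner_eq_dotProduct] at hg
  -- Equality in the Cauchy-Schwarz inequality gives an explicit vector of the kernel.
  set v : TangentSpace (𝓡 2) p :=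
    inner ℝ j₀ j₀ • tangentBasis p 1 - inner ℝ j₀ j₁ • tangentBasis p 0 with hv
  have hjv : derivIncl p v = inner ℝ j₀ j₀ • j₁ - inner ℝ j₀ j₁ • j₀ := by
    rw [hv, map_sub, map_smul, map_smul]
  have hv0 : derivIncl p v = 0 := by
    rw [hjv, ← inner_self_eq_zero (𝕜 := ℝ)]
    simp only [inner_sub_left, inner_sub_right, real_inner_smul_left, real_inner_smul_right]
    linear_combination -(inner ℝ j₀ j₀) * hg
  have hv1 : v = 0 := derivIncl_injective p (by rw [hv0, map_zero])
  have hv2 : inner ℝ j₀ j₀ = 0 := by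
    have := congrArg (fun w : EuclideanSpace ℝ (Fin 2) => w 1)
      (show (inner ℝ j₀ j₀ • EuclideanSpace.single 1 (1 : ℝ) -
        inner ℝ j₀ j₁ • EuclideanSpace.single 0 (1 : ℝ) : EuclideanSpace ℝ (Fin 2)) = 0 from hv1)
    simpa using this
  have hj0 : tangentBasis p 0 = 0 :=
    derivIncl_injective p (by rw [map_zero]; exact inner_self_eq_zero.1 hv2)
  have := congrArg (fun w : EuclideanSpace ℝ (Fin 2) => w 0)
    (show (EuclideanSpace.single 0 (1 : ℝ) : EuclideanSpace ℝ (Fin 2)) = 0 from hj0)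
  simp at this

/-! ### The area density as a determinant -/

/-- Given a null vector `m` with `eta t m = 1` and the projection `P` along `t`, this sends a
vector orthogonal to `m` to its representative modulo `m` in the Euclidean space `t^⊥`. -/
def shadow (t : Mink) (P : Mink →L[ℝ] (Fin 3 → ℝ)) (m : Mink) : Mink →L[ℝ] (Fin 3 → ℝ) :=
  P - (etaL t).smulRight (P m)

lemma shadow_apply (t : Mink) (P : Mink →L[ℝ] (Fin 3 → ℝ)) (m w : Mink) :
    shadow t P m w = P w - eta t w • P m := rfl

section Shadow

variable {t m : Mink} {P : Mink →L[ℝ] (Fin 3 → ℝ)}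

lemma projection_unit (hP : ∀ u v, eta u v = eta t u * eta t v - P u ⬝ᵥ P v)
    (hm : eta m m = 0) (htm : eta t m = 1) : P m ⬝ᵥ P m = 1 := by
  have := hP m m
  rw [hm, htm] at this
  linarith

lemma shadow_dotProduct_normal (hP : ∀ u v, eta u v = eta t u * eta t v - P u ⬝ᵥ P v)
    (hm : eta m m = 0) (htm : eta t m = 1) {w : Mink} (hw : eta m w = 0) :
    shadow t P m w ⬝ᵥ P m = 0 := by
  have h := hP w m
  rw [eta_comm, hw, htm] at h
  rw [shadow_apply, sub_dotProduct, smul_dotProduct, projection_unit hP hm htm, smul_eq_mul]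
  linarith

lemma shadow_dotProduct_shadow (hP : ∀ u v, eta u v = eta t u * eta t v - P u ⬝ᵥ P v)
    (hm : eta m m = 0) (htm : eta t m = 1) {w w' : Mink} (hw : eta m w = 0)
    (hw' : eta m w' = 0) :
    shadow t P m w ⬝ᵥ shadow t P m w' = -eta w w' := by
  have h := hP m w'
  rw [hw', htm] at h
  rw [shadow_apply t P m w', dotProduct_sub, dotProduct_smul,
    shadow_dotProduct_normal hP hm htm hw, shadow_apply, sub_dotProduct, smul_dotProduct,
    smul_eq_mul, smul_eq_mul, hP w w']
  linear_combination -eta t w * h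

/-- A linear map `L` from space to Minkowski space, composed with `shadow` and corrected so that
the direction `y` goes to `P m`. -/
def frameMap (t : Mink) (P : Mink →L[ℝ] (Fin 3 → ℝ)) (m : Mink) (L : E3 →L[ℝ] Mink) (y : E3) :
    E3 →L[ℝ] (Fin 3 → ℝ) :=
  P ∘L L - (etaL t ∘L L).smulRight (P m) + (innerSL ℝ y).smulRight (P m)

lemma frameMap_apply (L : E3 →L[ℝ] Mink) (y v : E3) :
    frameMap t P m L y v = shadow t P m (L v) + inner ℝ y v • P m := rfl

lemma frameMap_of_orthogonal (L : E3 →L[ℝ] Mink) {y v : E3} (h : inner ℝ y v = 0) :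
    frameMap t P m L y v = shadow t P m (L v) := by
  rw [frameMap_apply, h, zero_smul, add_zero]

lemma frameMap_self {L : E3 →L[ℝ] Mink} {p : Sph} (h : L p = 0) :
    frameMap t P m L p p = P m := by
  rw [frameMap_apply, h, map_zero, real_inner_self_eq_norm_sq, p.norm_eq]
  simp

lemma det3_frameMap_mul {L : E3 →L[ℝ] Mink} {p : Sph} (h : L p = 0)
    {v w : E3} (hv : inner ℝ (p : E3) v = 0) (hw : inner ℝ (p : E3) w = 0) :
    det3 (frameMap t P m L p) * triple (p : E3) v w =
      triple (P m) (shadow t P m (L v)) (shadow t P m (L w)) := by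
  rw [← triple_map, frameMap_self h, frameMap_of_orthogonal L hv, frameMap_of_orthogonal L hw]

lemma areaDensity_eq_abs_det3 (hP : ∀ u v, eta u v = eta t u * eta t v - P u ⬝ᵥ P v)
    (hm : eta m m = 0) (htm : eta t m = 1) {f : Sph → Mink} {p : Sph}
    (hf : DifferentiableAt ℝ (homExt f) p) (hmf : ∀ v, eta m (deriv₂ f p v) = 0) :
    areaDensity f p = |det3 (frameMap t P m (fderiv ℝ (homExt f) p) p)| := by
  set j := fun i => derivIncl p (tangentBasis p i) with hj
  have hmj : ∀ i, eta m (fderiv ℝ (homExt f) p (j i)) = 0 := fun i => by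
    rw [hj, ← deriv₂_eq_fderiv hf]; exact hmf _
  have hgram : (Matrix.of fun i k : Fin 2 => -eta (deriv₂ f p (tangentBasis p i))
      (deriv₂ f p (tangentBasis p k))).det =
      (det3 (frameMap t P m (fderiv ℝ (homExt f) p) p) * triple (p : E3) (j 0) (j 1)) ^ 2 := by
    rw [det3_frameMap_mul (fderiv_homExt_radial hf) (derivIncl_orthogonal p _)
      (derivIncl_orthogonal p _), triple_sq_of_unit_normal (projection_unit hP hm htm)
      (shadow_dotProduct_normal hP hm htm (hmj 0)) (shadow_dotProduct_normal hP hm htm (hmj 1)),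
      Matrix.det_fin_two]
    simp only [Matrix.of_apply, deriv₂_eq_fderiv hf]
    simp only [fun i k => shadow_dotProduct_shadow hP hm htm (hmj i) (hmj k)]
    rfl
  have hround : (Matrix.of fun i k : Fin 2 => inner ℝ (derivIncl p (tangentBasis p i))
      (derivIncl p (tangentBasis p k))).det = triple (p : E3) (j 0) (j 1) ^ 2 := by
    rw [triple_sq_of_unit_normal p.dotProduct_self (derivIncl_dotProduct p _)
      (derivIncl_dotProduct p _), Matrix.det_fin_two]
    simp only [Matrix.of_apply, E3_inner_eq_dotProduct]
  rw [areaDensity, hgram, hround, ← div_pow, Real.sqrt_sq_eq_abs,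
    mul_div_cancel_right₀ _ (triple_tangentBasis_ne_zero p)]

end Shadow

open MeasureTheory Set Real
open scoped ENNReal Pointwise

/-! ### Spherical coordinates -/

/-- The point of the unit sphere with colatitude `q.1` and longitude `q.2`. -/
def spherePt (q : ℝ × ℝ) : E3 := !₂[sin q.1 * cos q.2, sin q.1 * sin q.2, cos q.1]

lemma norm_spherePt (q : ℝ × ℝ) : ‖spherePt q‖ = 1 := by
  rw [EuclideanSpace.norm_eq, Real.sqrt_eq_one, Fin.sum_univ_three]
  simp only [spherePt, Real.norm_eq_abs, sq_abs]
  simp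
  linear_combination (sin q.1) ^ 2 * sin_sq_add_cos_sq q.2 + sin_sq_add_cos_sq q.1

/-- `spherePt` as a map to the sphere. -/
def sphereChart (q : ℝ × ℝ) : Sph := ⟨spherePt q, by simp [norm_spherePt]⟩

lemma contDiff_spherePt : ContDiff ℝ ∞ spherePt := by
  unfold spherePt
  rw [contDiff_euclidean]
  intro i
  fin_cases i <;> simp <;> fun_prop

lemma continuous_sphereChart : Continuous sphereChart :=
  contDiff_spherePt.continuous.subtype_mk _

/-- Integration over space in cylindrical coordinates. -/
lemma lintegral_cylindrical {F : E3 → ℝ≥0∞} (hF : Measurable F) :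
    ∫⁻ y, F y = ∫⁻ z : ℝ, ∫⁻ r in Ioi (0 : ℝ), ∫⁻ φ in Ioo (-π) π,
      ENNReal.ofReal r * F !₂[r * cos φ, r * sin φ, z] := by
  have hG : Measurable fun q : ℝ × (ℝ × ℝ) => F !₂[q.2.1, q.2.2, q.1] := by
    refine hF.comp (Continuous.measurable ?_)
    refine (PiLp.continuous_toLp 2 _).comp (continuous_pi fun i => ?_)
    fin_cases i <;> simp <;> fun_prop
  have h1 : ∫⁻ y, F y = ∫⁻ z : ℝ, ∫⁻ q : ℝ × ℝ, F !₂[q.1, q.2, z] := by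
    rw [← (PiLp.volume_preserving_toLp (Fin 3)).lintegral_comp hF]
    have h2 := ((volume_preserving_piFinSuccAbove (fun _ : Fin 3 => ℝ) 2).symm _).lintegral_comp
        (hF.comp (PiLp.volume_preserving_toLp (Fin 3)).measurable)
    refine h2.symm.trans ?_
    rw [Measure.volume_eq_prod, lintegral_prod]
    · refine lintegral_congr fun z => ?_
      have h3 := (volume_preserving_finTwoArrow ℝ).lintegral_comp
        (hG.comp (measurable_prodMk_left (x := z)))
      refine Eq.trans (lintegral_congr fun w => ?_) h3
      simp only [Function.comp]
      congr 2
      ext i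
      fin_cases i <;> rfl
    · exact (hF.comp ((PiLp.volume_preserving_toLp (Fin 3)).measurable.comp
        (MeasurableEquiv.measurable _))).aemeasurable
  rw [h1]
  refine lintegral_congr fun z => ?_
  rw [← lintegral_comp_polarCoord_symm, polarCoord_target, Measure.volume_eq_prod,
    setLIntegral_prod]
  · simp
  · refine (Measurable.mul (by fun_prop) ?_).aemeasurable
    exact (hG.comp measurable_prodMk_left).comp continuous_polarCoord_symm.measurable

/-- Integration over space in spherical coordinates. -/
lemma lintegral_spherical {F : E3 → ℝ≥0∞} (hF : Measurable F) :
    ∫⁻ y, F y = ∫⁻ R in Ioi (0 : ℝ), ∫⁻ θ in Ioo 0 π, ∫⁻ φ in Ioo (-π) π,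
      ENNReal.ofReal (R ^ 2 * sin θ) * F (R • spherePt (θ, φ)) := by
  rw [lintegral_cylindrical hF]
  set K : ℝ × ℝ → ℝ≥0∞ := fun q =>
    ∫⁻ φ in Ioo (-π) π, ENNReal.ofReal q.2 * F !₂[q.2 * cos φ, q.2 * sin φ, q.1] with hK
  have hKm : Measurable K := by
    refine Measurable.lintegral_prod_right' (f := fun u : (ℝ × ℝ) × ℝ =>
      ENNReal.ofReal u.1.2 * F !₂[u.1.2 * cos u.2, u.1.2 * sin u.2, u.1.1]) ?_
    refine Measurable.mul (by fun_prop) (hF.comp (Continuous.measurable ?_))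
    refine (PiLp.continuous_toLp 2 _).comp (continuous_pi fun i => ?_)
    fin_cases i <;> simp <;> fun_prop
  have hset : MeasurableSet {q : ℝ × ℝ | 0 < q.2} :=
    measurableSet_lt measurable_const measurable_snd
  have hIm := hKm.indicator hset
  have h1 : ∫⁻ z : ℝ, ∫⁻ r in Ioi (0 : ℝ), K (z, r) =
      ∫⁻ q : ℝ × ℝ, {q : ℝ × ℝ | 0 < q.2}.indicator K q := by
    rw [Measure.volume_eq_prod, lintegral_prod _ hIm.aemeasurable]
    refine lintegral_congr fun z => ?_
    rw [← lintegral_indicator measurableSet_Ioi]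
    rfl
  refine h1.trans ?_
  -- Polar coordinates in the half-plane of the axial and the radial cylindrical coordinate.
  rw [← lintegral_comp_polarCoord_symm, polarCoord_target, Measure.volume_eq_prod,
    setLIntegral_prod]
  swap
  · exact (Measurable.mul (by fun_prop)
      (hIm.comp continuous_polarCoord_symm.measurable)).aemeasurable
  refine setLIntegral_congr_fun measurableSet_Ioi fun R hR => ?_
  have hR' : 0 < R := hR
  rw [← lintegral_indicator measurableSet_Ioo, ← lintegral_indicator measurableSet_Ioo]
  refine lintegral_congr fun θ => ?_
  by_cases hθ : θ ∈ Ioo 0 π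
  · have hs : 0 < sin θ := sin_pos_of_mem_Ioo hθ
    rw [indicator_of_mem hθ,
      indicator_of_mem (show θ ∈ Ioo (-π) π from ⟨by linarith [hθ.1, pi_pos], hθ.2⟩),
      polarCoord_symm_apply, indicator_of_mem (by simpa using mul_pos hR' hs), hK, smul_eq_mul,
      ← lintegral_const_mul']
    · refine lintegral_congr fun φ => ?_
      rw [← mul_assoc, ← ENNReal.ofReal_mul hR'.le]
      congr 2
      · ring
      · ext i
        fin_cases i <;> simp [spherePt] <;> ring
    · exact ENNReal.ofReal_ne_top
  · rw [indicator_of_notMem hθ]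
    by_cases hθ' : θ ∈ Ioo (-π) π
    · have hle : θ ≤ 0 := by
        by_contra h
        exact hθ ⟨not_le.1 h, hθ'.2⟩
      have hs : sin θ ≤ 0 := sin_nonpos_of_nonpos_of_neg_pi_le hle hθ'.1.le
      rw [indicator_of_mem hθ', indicator_of_notMem, smul_zero]
      simpa using mul_nonpos_of_nonneg_of_nonpos hR'.le hs
    · rw [indicator_of_notMem hθ']

/-- The coordinate rectangle with the area density of the round sphere. -/
def rectMeasure : Measure (ℝ × ℝ) :=
  ((volume.restrict (Ioo 0 π)).prod (volume.restrict (Ioo (-π) π))).withDensity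
    fun q => ENNReal.ofReal (sin q.1)

lemma measurable_radial : Measurable radial := by
  refine measurable_of_continuousOn_compl_singleton 0 fun y hy => ?_
  exact (contMDiffAt_radial hy).continuousAt.continuousWithinAt

/-- The cone over a set of the sphere; its volume is a third of the round measure of the set. -/
lemma mem_cone_iff {s : Set Sph} {y : E3} :
    y ∈ Ioo (0 : ℝ) 1 • ((↑) '' s : Set E3) ↔ y ≠ 0 ∧ ‖y‖ < 1 ∧ radial y ∈ s := by
  constructor
  · rintro ⟨c, hc, _, ⟨p, hp, rfl⟩, rfl⟩
    refine ⟨smul_ne_zero hc.1.ne' p.ne_zero, ?_, ?_⟩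
    · rw [norm_smul, p.norm_eq, mul_one, Real.norm_eq_abs, abs_of_pos hc.1]
      exact hc.2
    · simpa only [radial_smul hc.1] using hp
  · rintro ⟨h0, h1, h2⟩
    refine ⟨‖y‖, ⟨norm_pos_iff.2 h0, h1⟩, _, ⟨radial y, h2, rfl⟩, ?_⟩
    simp only [radial_of_ne h0, smul_smul, mul_inv_cancel₀ (norm_ne_zero_iff.2 h0), one_smul]

/-- Both measures of a set are three times the volume of the cone over it. -/
lemma roundMeasure_eq_map : roundMeasure = rectMeasure.map sphereChart := by
  ext s hs
  have hpre : MeasurableSet (sphereChart ⁻¹' s) := continuous_sphereChart.measurable hs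
  have hcone : MeasurableSet (Ioo (0 : ℝ) 1 • ((↑) '' s : Set E3)) := by
    have : Ioo (0 : ℝ) 1 • ((↑) '' s : Set E3) = {0}ᶜ ∩ ({y | ‖y‖ < 1} ∩ radial ⁻¹' s) := by
      ext y; exact mem_cone_iff
    rw [this]
    exact (measurableSet_singleton _).compl.inter
      ((measurableSet_lt measurable_norm measurable_const).inter (measurable_radial hs))
  rw [Measure.map_apply continuous_sphereChart.measurable hs, roundMeasure,
    Measure.toSphere_apply' _ hs, finrank_euclideanSpace_fin, rectMeasure,
    withDensity_apply _ hpre, ← lintegral_indicator hpre, ← lintegral_indicator_one hcone,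
    lintegral_spherical (measurable_one.indicator hcone)]
  have hm : Measurable ((sphereChart ⁻¹' s).indicator fun q : ℝ × ℝ => ENNReal.ofReal (sin q.1)) :=
    Measurable.indicator (by fun_prop) hpre
  rw [lintegral_prod _ hm.aemeasurable]
  set I := ∫⁻ θ in Ioo 0 π, ∫⁻ φ in Ioo (-π) π,
    (sphereChart ⁻¹' s).indicator (fun q : ℝ × ℝ => ENNReal.ofReal (sin q.1)) (θ, φ) with hI
  have hinner : ∀ R ∈ Ioi (0 : ℝ), (∫⁻ θ in Ioo 0 π, ∫⁻ φ in Ioo (-π) π,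
      ENNReal.ofReal (R ^ 2 * sin θ) *
        (Ioo (0 : ℝ) 1 • ((↑) '' s : Set E3)).indicator 1 (R • spherePt (θ, φ))) =
      (Iio 1).indicator (fun R => ENNReal.ofReal (R ^ 2)) R * I := by
    intro R hR
    have hR' : 0 < R := hR
    have hmem : ∀ q, R • spherePt q ∈ Ioo (0 : ℝ) 1 • ((↑) '' s : Set E3) ↔
        R < 1 ∧ sphereChart q ∈ s := fun q => by
      have h1 : radial (R • spherePt q) = sphereChart q := radial_smul hR' (sphereChart q)
      have h2 : R • spherePt q ≠ 0 := smul_ne_zero hR'.ne' (sphereChart q).ne_zero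
      rw [mem_cone_iff, h1, norm_smul, norm_spherePt, mul_one, Real.norm_eq_abs, abs_of_pos hR']
      simp [h2]
    rw [hI, ← lintegral_const_mul _ hm.lintegral_prod_right']
    refine lintegral_congr fun θ => ?_
    refine Eq.trans (lintegral_congr fun φ => ?_)
      (lintegral_const_mul _ (hm.comp (measurable_prodMk_left (x := θ))))
    by_cases hR1 : R < 1 <;> by_cases hq : sphereChart (θ, φ) ∈ s
    · rw [indicator_of_mem ((hmem _).2 ⟨hR1, hq⟩), indicator_of_mem (show R ∈ Iio 1 from hR1),
        indicator_of_mem (show (θ, φ) ∈ sphereChart ⁻¹' s from hq),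
        ← ENNReal.ofReal_mul (by positivity)]
      simp
    · rw [indicator_of_notMem (fun h => hq ((hmem _).1 h).2),
        indicator_of_notMem (show (θ, φ) ∉ sphereChart ⁻¹' s from hq)]
      simp
    · rw [indicator_of_notMem (fun h => hR1 ((hmem _).1 h).1),
        indicator_of_notMem (show R ∉ Iio 1 from hR1)]
      simp
    · rw [indicator_of_notMem (fun h => hR1 ((hmem _).1 h).1),
        indicator_of_notMem (show R ∉ Iio 1 from hR1)]
      simp
  rw [setLIntegral_congr_fun measurableSet_Ioi hinner,
    lintegral_mul_const _ (Measurable.indicator (by fun_prop) measurableSet_Iio)]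
  have hrad : ∫⁻ R in Ioi (0 : ℝ), (Iio 1).indicator (fun R => ENNReal.ofReal (R ^ 2)) R =
      ENNReal.ofReal (1 / 3) := by
    rw [setLIntegral_indicator measurableSet_Iio, inter_comm, Ioi_inter_Iio,
      Measure.restrict_congr_set Ioo_ae_eq_Ioc, ← ofReal_integral_eq_lintegral_ofReal
        (intervalIntegral.intervalIntegrable_pow 2).1, ← intervalIntegral.integral_of_le zero_le_one]
    · norm_num
    · exact Filter.Eventually.of_forall fun y => sq_nonneg y
  rw [hrad, ← mul_assoc]
  have : ((3 : ℕ) : ℝ≥0∞) * ENNReal.ofReal (1 / 3) = 1 := by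
    rw [← ENNReal.ofReal_natCast, ← ENNReal.ofReal_mul (by norm_num)]
    norm_num
  rw [this, one_mul]

instance : IsFiniteMeasure roundMeasure := by
  unfold roundMeasure; infer_instance

lemma integrable_of_continuous {g : Sph → ℝ} (hg : Continuous g) : Integrable g roundMeasure := by
  have := hg.continuousOn.integrableOn_compact (μ := roundMeasure) isCompact_univ
  rwa [integrableOn_univ] at this

/-- The integral over the round sphere in spherical coordinates. -/
lemma integral_roundMeasure {g : Sph → ℝ} (hg : Continuous g) :
    ∫ p, g p ∂roundMeasure =
      ∫ θ in (0 : ℝ)..π, ∫ φ in -π..π, sin θ * g (sphereChart (θ, φ)) := by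
  rw [roundMeasure_eq_map, integral_map continuous_sphereChart.measurable.aemeasurable
    hg.aestronglyMeasurable, rectMeasure]
  have hcont : Continuous fun q : ℝ × ℝ => sin q.1 * g (sphereChart q) := by
    have := continuous_sphereChart
    fun_prop
  have h1 : ∀ᵐ q ∂((volume.restrict (Ioo 0 π)).prod (volume.restrict (Ioo (-π) π))),
      (ENNReal.ofReal (sin q.1)).toReal • g (sphereChart q) = sin q.1 * g (sphereChart q) := by
    rw [Measure.prod_restrict]
    filter_upwards [ae_restrict_mem (measurableSet_Ioo.prod measurableSet_Ioo)] with q hq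
    rw [ENNReal.toReal_ofReal (sin_pos_of_mem_Ioo hq.1).le, smul_eq_mul]
  rw [integral_withDensity_eq_integral_toReal_smul (by fun_prop) (by simp), integral_congr_ae h1,
    integral_prod]
  · rw [intervalIntegral.integral_of_le pi_pos.le, integral_Ioc_eq_integral_Ioo]
    congr 1
    ext θ
    rw [intervalIntegral.integral_of_le (by linarith [pi_pos]), integral_Ioc_eq_integral_Ioo]
  · rw [Measure.prod_restrict, ← Measure.volume_eq_prod]
    exact (hcont.continuousOn.integrableOn_compact
      (isCompact_Icc.prod isCompact_Icc)).mono_set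
        (Set.prod_mono Ioo_subset_Icc_self Ioo_subset_Icc_self)

/-! ### The connection form of a moving frame -/

section TripleCalculus

variable {G : Type*} [NormedAddCommGroup G] [NormedSpace ℝ G]

lemma contDiffAt_triple {u v w : G → Fin 3 → ℝ} {y : G} (hu : ContDiffAt ℝ ∞ u y)
    (hv : ContDiffAt ℝ ∞ v y) (hw : ContDiffAt ℝ ∞ w y) :
    ContDiffAt ℝ ∞ (fun y => triple (u y) (v y) (w y)) y := by
  unfold triple
  have hu' := contDiffAt_pi.1 hu
  have hv' := contDiffAt_pi.1 hv
  have hw' := contDiffAt_pi.1 hw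
  exact (((hu' 0).mul (((hv' 1).mul (hw' 2)).sub ((hv' 2).mul (hw' 1)))).sub
    ((hu' 1).mul (((hv' 0).mul (hw' 2)).sub ((hv' 2).mul (hw' 0))))).add
    ((hu' 2).mul (((hv' 0).mul (hw' 1)).sub ((hv' 1).mul (hw' 0))))

lemma contDiffAt_dotProduct {u v : G → Fin 3 → ℝ} {y : G} (hu : ContDiffAt ℝ ∞ u y)
    (hv : ContDiffAt ℝ ∞ v y) : ContDiffAt ℝ ∞ (fun y => u y ⬝ᵥ v y) y := by
  simp only [dotProduct]
  exact ContDiffAt.sum fun i _ => (contDiffAt_pi.1 hu i).mul (contDiffAt_pi.1 hv i)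

lemma contDiffAt_crossProduct {u v : G → Fin 3 → ℝ} {y : G} (hu : ContDiffAt ℝ ∞ u y)
    (hv : ContDiffAt ℝ ∞ v y) : ContDiffAt ℝ ∞ (fun y => u y ⨯₃ v y) y := by
  have hu' := contDiffAt_pi.1 hu
  have hv' := contDiffAt_pi.1 hv
  simp only [cross_apply]
  refine contDiffAt_pi.2 fun i => ?_
  fin_cases i
  · exact ((hu' 1).mul (hv' 2)).sub ((hu' 2).mul (hv' 1))
  · exact ((hu' 2).mul (hv' 0)).sub ((hu' 0).mul (hv' 2))
  · exact ((hu' 0).mul (hv' 1)).sub ((hu' 1).mul (hv' 0))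

lemma fderiv_triple {u v w : G → Fin 3 → ℝ} {y : G} (hu : DifferentiableAt ℝ u y)
    (hv : DifferentiableAt ℝ v y) (hw : DifferentiableAt ℝ w y) (d : G) :
    fderiv ℝ (fun y => triple (u y) (v y) (w y)) y d =
      triple (fderiv ℝ u y d) (v y) (w y) + triple (u y) (fderiv ℝ v y d) (w y) +
        triple (u y) (v y) (fderiv ℝ w y d) := by
  have hu' := hasFDerivAt_pi'.1 hu.hasFDerivAt
  have hv' := hasFDerivAt_pi'.1 hv.hasFDerivAt
  have hw' := hasFDerivAt_pi'.1 hw.hasFDerivAt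
  have h := (((hu' 0).mul (((hv' 1).mul (hw' 2)).sub ((hv' 2).mul (hw' 1)))).sub
    ((hu' 1).mul (((hv' 0).mul (hw' 2)).sub ((hv' 2).mul (hw' 0))))).add
    ((hu' 2).mul (((hv' 0).mul (hw' 1)).sub ((hv' 1).mul (hw' 0))))
  have h2 : HasFDerivAt (fun y => triple (u y) (v y) (w y)) _ y := h
  rw [h2.fderiv]
  simp [triple]
  ring

lemma fderiv_dotProduct {u v : G → Fin 3 → ℝ} {y : G} (hu : DifferentiableAt ℝ u y)
    (hv : DifferentiableAt ℝ v y) (d : G) :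
    fderiv ℝ (fun y => u y ⬝ᵥ v y) y d = fderiv ℝ u y d ⬝ᵥ v y + u y ⬝ᵥ fderiv ℝ v y d := by
  have hu' := hasFDerivAt_pi'.1 hu.hasFDerivAt
  have hv' := hasFDerivAt_pi'.1 hv.hasFDerivAt
  have h : HasFDerivAt (fun y => u y ⬝ᵥ v y) _ y :=
    HasFDerivAt.fun_sum (u := Finset.univ) fun i _ => (hu' i).mul (hv' i)
  rw [h.fderiv]
  simp [dotProduct, Fin.sum_univ_three]
  ring

lemma fderiv_apply_one_zero {f : ℝ × ℝ → G} {θ φ : ℝ} (hf : DifferentiableAt ℝ f (θ, φ)) {v : G}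
    (h : HasDerivAt (fun s => f (s, φ)) v θ) : fderiv ℝ f (θ, φ) (1, 0) = v :=
  (hf.hasFDerivAt.comp_hasDerivAt θ ((hasDerivAt_id θ).prodMk (hasDerivAt_const θ φ))).unique h

lemma fderiv_apply_zero_one {f : ℝ × ℝ → G} {θ φ : ℝ} (hf : DifferentiableAt ℝ f (θ, φ)) {v : G}
    (h : HasDerivAt (fun s => f (θ, s)) v φ) : fderiv ℝ f (θ, φ) (0, 1) = v :=
  (hf.hasFDerivAt.comp_hasDerivAt φ ((hasDerivAt_const φ θ).prodMk (hasDerivAt_id φ))).unique h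

end TripleCalculus

/-- The structure equation of an adapted frame: if `E` is a unit field orthogonal to the unit
field `N`, then the exterior derivative of the connection form `triple N E dE` is minus the area
form pulled back by `N`. The left side is that exterior derivative without the second
derivatives, which cancel. -/
lemma structure_equation {N E N₁ N₂ E₁ E₂ : Fin 3 → ℝ} (hN : N ⬝ᵥ N = 1) (hE : E ⬝ᵥ E = 1)
    (hNE : N ⬝ᵥ E = 0) (hN₁ : N₁ ⬝ᵥ N = 0) (hN₂ : N₂ ⬝ᵥ N = 0) (hE₁ : E₁ ⬝ᵥ E = 0)
    (hE₂ : E₂ ⬝ᵥ E = 0) (h₁ : N₁ ⬝ᵥ E + N ⬝ᵥ E₁ = 0) (h₂ : N₂ ⬝ᵥ E + N ⬝ᵥ E₂ = 0) :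
    (triple N₁ E E₂ + triple N E₁ E₂) - (triple N₂ E E₁ + triple N E₂ E₁) =
      -triple N N₁ N₂ := by
  -- All determinants are computed in the orthonormal basis `N`, `E`, `F`.
  set F := N ⨯₃ E with hF
  have hNEF : triple N E F = 1 := by
    have h : triple N E F = (N ⬝ᵥ N) * (E ⬝ᵥ E) - (N ⬝ᵥ E) ^ 2 := by
      simp only [triple, dotProduct, Fin.sum_univ_three, hF, cross_apply]
      simp
      ring
    rw [h, hN, hE, hNE]; norm_num
  have hEF : E ⬝ᵥ F = 0 := by rw [hF, dot_cross_self]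
  have hNF : N ⬝ᵥ F = 0 := by rw [hF, dot_self_cross]
  have hEN : E ⬝ᵥ N = 0 := by rw [dotProduct_comm, hNE]
  have e₁ : E₁ ⬝ᵥ N = -(N₁ ⬝ᵥ E) := by rw [dotProduct_comm]; linarith
  have e₂ : E₂ ⬝ᵥ N = -(N₂ ⬝ᵥ E) := by rw [dotProduct_comm]; linarith
  have k := fun a b c => triple_mul_triple a b c N E F
  simp only [hNEF, mul_one] at k
  simp only [k, hN, hE, hNE, hN₁, hN₂, hE₁, hE₂, hEF, hNF, hEN, e₁, e₂]
  ring

/-- Stokes' theorem for the connection form of the frame `N`, `E` on the coordinate rectangle,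
whose values on the two sides that represent the poles are `ε` and `-ε`. -/
lemma integral_area_of_unit_frame {N E : ℝ × ℝ → Fin 3 → ℝ} (hN : ContDiff ℝ ∞ N)
    (hE : ContDiff ℝ ∞ E) (hNN : ∀ q, N q ⬝ᵥ N q = 1) (hEE : ∀ q, E q ⬝ᵥ E q = 1)
    (hNE : ∀ q, N q ⬝ᵥ E q = 0) (hNp : ∀ θ, N (θ, π) = N (θ, -π))
    (hEp : ∀ θ, E (θ, π) = E (θ, -π)) {ε : ℝ}
    (h₀ : ∀ φ, triple (N (0, φ)) (E (0, φ)) (fderiv ℝ E (0, φ) (0, 1)) = ε)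
    (h₁ : ∀ φ, triple (N (π, φ)) (E (π, φ)) (fderiv ℝ E (π, φ) (0, 1)) = -ε) :
    ∫ θ in (0 : ℝ)..π, ∫ φ in -π..π, triple (N (θ, φ)) (fderiv ℝ N (θ, φ) (1, 0))
      (fderiv ℝ N (θ, φ) (0, 1)) = 4 * π * ε := by
  have hE' : ∀ d : ℝ × ℝ, ContDiff ℝ ∞ fun q => fderiv ℝ E q d := fun d =>
    (hE.fderiv_right (m := ∞) (by simp)).clm_apply contDiff_const
  have hω : ∀ d : ℝ × ℝ, ContDiff ℝ ∞ fun q => triple (N q) (E q) (fderiv ℝ E q d) := fun d =>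
    contDiff_iff_contDiffAt.2 fun q =>
      contDiffAt_triple hN.contDiffAt hE.contDiffAt (hE' d).contDiffAt
  set f : ℝ × ℝ → ℝ := fun q => triple (N q) (E q) (fderiv ℝ E q (0, 1)) with hf
  set g : ℝ × ℝ → ℝ := fun q => -triple (N q) (E q) (fderiv ℝ E q (1, 0)) with hg
  have hfs : ContDiff ℝ ∞ f := hω _
  have hgs : ContDiff ℝ ∞ g := (hω _).neg
  have hNd := fun q => hN.differentiable (by simp) q
  have hEd := fun q => hE.differentiable (by simp) q
  have hE'd := fun d q => (hE' d).differentiable (by simp) q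
  have hdω : ∀ q, fderiv ℝ f q (1, 0) + fderiv ℝ g q (0, 1) =
      -triple (N q) (fderiv ℝ N q (1, 0)) (fderiv ℝ N q (0, 1)) := by
    intro q
    have hswap : fderiv ℝ (fun q => fderiv ℝ E q (0, 1)) q (1, 0) =
        fderiv ℝ (fun q => fderiv ℝ E q (1, 0)) q (0, 1) := by
      have hd : DifferentiableAt ℝ (fderiv ℝ E) q :=
        (hE.fderiv_right (m := ∞) (by simp)).differentiable (by simp) q
      rw [fderiv_clm_apply hd (differentiableAt_const _),
        fderiv_clm_apply hd (differentiableAt_const _)]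
      have hsym := (hE.contDiffAt (x := q)).isSymmSndFDerivAt
        (by rw [minSmoothness_of_isRCLikeNormedField]
            exact WithTop.coe_le_coe.2 (le_top : (2 : ℕ∞) ≤ ⊤))
      simpa using hsym (1, 0) (0, 1)
    have hunit : ∀ {u : ℝ × ℝ → Fin 3 → ℝ}, (∀ q, DifferentiableAt ℝ u q) →
        (∀ q, u q ⬝ᵥ u q = 1) → ∀ d, fderiv ℝ u q d ⬝ᵥ u q = 0 := by
      intro u hu huu d
      have h := fderiv_dotProduct (hu q) (hu q) d
      rw [funext huu, dotProduct_comm (u q)] at h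
      simp at h
      linarith
    have horth : ∀ d, fderiv ℝ N q d ⬝ᵥ E q + N q ⬝ᵥ fderiv ℝ E q d = 0 := by
      intro d
      have h := fderiv_dotProduct (hNd q) (hEd q) d
      rw [funext hNE] at h
      simp at h
      exact h.symm
    rw [← structure_equation (hNN q) (hEE q) (hNE q) (hunit hNd hNN (1, 0))
      (hunit hNd hNN (0, 1)) (hunit hEd hEE (1, 0)) (hunit hEd hEE (0, 1))
      (horth (1, 0)) (horth (0, 1)), hf, hg, fderiv_triple (hNd q) (hEd q) (hE'd _ q),
      fderiv_fun_neg, _root_.neg_apply,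
      fderiv_triple (hNd q) (hEd q) (hE'd _ q), hswap]
    ring
  have hS := integral2_divergence_prod_of_hasFDerivAt f g (fderiv ℝ f) (fderiv ℝ g) 0 (-π) π π
    hfs.continuous.continuousOn hgs.continuous.continuousOn
    (fun q _ => (hfs.differentiable (by simp) q).hasFDerivAt)
    (fun q _ => (hgs.differentiable (by simp) q).hasFDerivAt)
    (by
      have h1 := (hfs.continuous_fderiv (by simp)).clm_apply
        (continuous_const (y := ((1 : ℝ), (0 : ℝ))))
      have h2 := (hgs.continuous_fderiv (by simp)).clm_apply
        (continuous_const (y := ((0 : ℝ), (1 : ℝ))))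
      exact (h1.add h2).continuousOn.integrableOn_compact (isCompact_uIcc.prod isCompact_uIcc))
  -- The two sides that represent the cut meridian contribute equally.
  have hgp : ∀ θ, g (θ, π) = g (θ, -π) := by
    intro θ
    have hline : ∀ c, fderiv ℝ E (θ, c) (1, 0) = deriv (fun s => E (s, c)) θ := fun c => by
      have hd : DifferentiableAt ℝ (fun s => E (s, c)) θ :=
        (hEd (θ, c)).comp θ (differentiableAt_id.prodMk (differentiableAt_const c))
      exact fderiv_apply_one_zero (hEd _) hd.hasDerivAt
    simp only [hg, hline, hNp, hEp]
  have hfπ : ∀ φ, f (π, φ) = -ε := h₁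
  have hf0 : ∀ φ, f (0, φ) = ε := h₀
  simp only [hdω, hgp, hfπ, hf0, intervalIntegral.integral_neg, intervalIntegral.integral_const,
    smul_eq_mul] at hS
  linarith

/-- `integral_area_of_unit_frame` for a frame vector that need not be normalised. On the
polar sides it rotates about `N` with angular velocity `±ε`. -/
lemma integral_area_of_frame {N a : ℝ × ℝ → Fin 3 → ℝ} (hN : ContDiff ℝ ∞ N)
    (ha : ContDiff ℝ ∞ a) (hNN : ∀ q, N q ⬝ᵥ N q = 1) (haa : ∀ q, 0 < a q ⬝ᵥ a q)
    (hNa : ∀ q, N q ⬝ᵥ a q = 0) (hNp : ∀ θ, N (θ, π) = N (θ, -π))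
    (hap : ∀ θ, a (θ, π) = a (θ, -π)) {ε : ℝ}
    (h₀ : ∀ φ, HasDerivAt (fun φ => a (0, φ)) (ε • (N (0, φ) ⨯₃ a (0, φ))) φ)
    (h₁ : ∀ φ, HasDerivAt (fun φ => a (π, φ)) (-ε • (N (π, φ) ⨯₃ a (π, φ))) φ) :
    ∫ θ in (0 : ℝ)..π, ∫ φ in -π..π, triple (N (θ, φ)) (fderiv ℝ N (θ, φ) (1, 0))
      (fderiv ℝ N (θ, φ) (0, 1)) = 4 * π * ε := by
  set r : ℝ × ℝ → ℝ := fun q => (√(a q ⬝ᵥ a q))⁻¹ with hr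
  have hrs : ContDiff ℝ ∞ r := contDiff_iff_contDiffAt.2 fun q =>
    ((contDiffAt_dotProduct ha.contDiffAt ha.contDiffAt).sqrt (haa q).ne').inv
      (Real.sqrt_pos.2 (haa q)).ne'
  have hrr : ∀ q, r q * r q * (a q ⬝ᵥ a q) = 1 := fun q => by
    have h := Real.mul_self_sqrt (haa q).le
    have h0 := (Real.sqrt_pos.2 (haa q)).ne'
    simp only [hr]
    nth_rewrite 3 [← h]
    field_simp
  have hEs : ContDiff ℝ ∞ fun q => r q • a q := hrs.smul ha
  have hside : ∀ c k : ℝ,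
      (∀ φ, HasDerivAt (fun φ => a (c, φ)) (k • (N (c, φ) ⨯₃ a (c, φ))) φ) → ∀ φ,
      triple (N (c, φ)) (r (c, φ) • a (c, φ)) (fderiv ℝ (fun q => r q • a q) (c, φ) (0, 1)) = k := by
    intro c k h φ
    have hd : DifferentiableAt ℝ (fun s => r (c, s)) φ :=
      (hrs.differentiable (by simp) (c, φ)).comp φ
        ((differentiableAt_const c).prodMk differentiableAt_id)
    rw [fderiv_apply_zero_one (hEs.differentiable (by simp) _) (hd.hasDerivAt.smul (h φ))]
    have e : ∀ s : ℝ, triple (N (c, φ)) (r (c, φ) • a (c, φ))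
        (r (c, φ) • k • (N (c, φ) ⨯₃ a (c, φ)) + s • a (c, φ)) =
        k * (r (c, φ) * r (c, φ) * ((a (c, φ) ⬝ᵥ a (c, φ)) * (N (c, φ) ⬝ᵥ N (c, φ)) -
          (N (c, φ) ⬝ᵥ a (c, φ)) ^ 2)) := by
      intro s
      simp only [triple, dotProduct, Fin.sum_univ_three, cross_apply]
      simp
      ring
    refine (e _).trans ?_
    rw [hNN, hNa]
    linear_combination k * hrr (c, φ)
  refine integral_area_of_unit_frame hN hEs hNN (fun q => ?_) (fun q => ?_) hNp (fun θ => ?_)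
    (hside 0 ε h₀) (hside π (-ε) h₁)
  · rw [smul_dotProduct, dotProduct_smul, smul_eq_mul, smul_eq_mul, ← mul_assoc, hrr]
  · rw [dotProduct_smul, hNa, smul_zero]
  · simp only [hr, hap]

/-! ### The degree of a Gauss map covered by a bundle isomorphism -/

/-- The unit tangent vector of the sphere in the direction of increasing colatitude; it is defined
and smooth at the poles too. -/
def eTheta (q : ℝ × ℝ) : E3 := !₂[cos q.1 * cos q.2, cos q.1 * sin q.2, -sin q.1]

/-- The unit tangent vector of the sphere in the direction of increasing longitude. -/
def ePhi (q : ℝ × ℝ) : E3 := !₂[-sin q.2, cos q.2, 0]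

lemma contDiff_eTheta : ContDiff ℝ ∞ eTheta := by
  unfold eTheta
  rw [contDiff_euclidean]
  intro i
  fin_cases i <;> simp <;> fun_prop

lemma contDiff_ePhi : ContDiff ℝ ∞ ePhi := by
  unfold ePhi
  rw [contDiff_euclidean]
  intro i
  fin_cases i <;> simp <;> fun_prop

lemma inner_spherePt_eTheta (q : ℝ × ℝ) : inner ℝ (spherePt q) (eTheta q) = 0 := by
  rw [E3_inner_eq_dotProduct]
  simp [spherePt, eTheta, dotProduct, Fin.sum_univ_three]
  linear_combination (sin q.1 * cos q.1) * sin_sq_add_cos_sq q.2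

lemma inner_spherePt_ePhi (q : ℝ × ℝ) : inner ℝ (spherePt q) (ePhi q) = 0 := by
  rw [E3_inner_eq_dotProduct]
  simp [spherePt, ePhi, dotProduct, Fin.sum_univ_three]
  ring

lemma triple_spherePt_eTheta_ePhi (q : ℝ × ℝ) :
    triple (spherePt q) (eTheta q) (ePhi q) = 1 := by
  simp [spherePt, eTheta, ePhi, triple]
  linear_combination
    sin_sq_add_cos_sq q.1 + (sin q.1 ^ 2 + cos q.1 ^ 2) * sin_sq_add_cos_sq q.2

lemma hasDerivAt_E3 {f : ℝ → E3} {f' : E3} {s : ℝ}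
    (h : ∀ i, HasDerivAt (fun s => f s i) (f' i) s) : HasDerivAt f f' s :=
  (PiLp.continuousLinearEquiv 2 ℝ fun _ : Fin 3 => ℝ).symm.hasFDerivAt.comp_hasDerivAt s
    (hasDerivAt_pi.2 h)

lemma fderiv_spherePt_one_zero (q : ℝ × ℝ) : fderiv ℝ spherePt q (1, 0) = eTheta q := by
  refine fderiv_apply_one_zero (contDiff_spherePt.differentiable (by simp) _)
    (hasDerivAt_E3 fun i => ?_)
  fin_cases i <;> simp only [spherePt, eTheta]
  · exact (hasDerivAt_sin _).mul_const _
  · exact (hasDerivAt_sin _).mul_const _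
  · exact hasDerivAt_cos _

lemma fderiv_spherePt_zero_one (q : ℝ × ℝ) :
    fderiv ℝ spherePt q (0, 1) = sin q.1 • ePhi q := by
  refine fderiv_apply_zero_one (contDiff_spherePt.differentiable (by simp) _)
    (hasDerivAt_E3 fun i => ?_)
  fin_cases i <;> simp only [spherePt, ePhi]
  · simpa using (hasDerivAt_cos q.2).const_mul (sin q.1)
  · simpa using (hasDerivAt_sin q.2).const_mul (sin q.1)
  · simpa using hasDerivAt_const q.2 (cos q.1)

section Poles

variable {c k : ℝ}

lemma spherePt_pole (hs : sin c = 0) (φ : ℝ) : spherePt (c, φ) = spherePt (c, 0) := by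
  ext i
  fin_cases i <;> simp [spherePt, hs]

lemma hasDerivAt_eTheta_pole (hc : cos c = k) (φ : ℝ) :
    HasDerivAt (fun φ => eTheta (c, φ)) (k • ePhi (c, φ)) φ := by
  refine hasDerivAt_E3 fun i => ?_
  fin_cases i <;> simp only [eTheta, ePhi, hc]
  · simpa using (hasDerivAt_cos φ).const_mul k
  · simpa using (hasDerivAt_sin φ).const_mul k
  · simpa using hasDerivAt_const φ (-sin c)

lemma hasDerivAt_ePhi_pole (hs : sin c = 0) (hc : cos c = k) (hk : k ^ 2 = 1) (φ : ℝ) :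
    HasDerivAt (fun φ => ePhi (c, φ)) (-k • eTheta (c, φ)) φ := by
  refine hasDerivAt_E3 fun i => ?_
  fin_cases i <;> simp only [eTheta, ePhi, hc]
  · have := (hasDerivAt_sin φ).fun_neg
    refine this.congr_deriv ?_
    change -cos φ = -k * (k * cos φ)
    linear_combination cos φ * hk
  · have := hasDerivAt_cos φ
    refine this.congr_deriv ?_
    change -sin φ = -k * (k * sin φ)
    linear_combination sin φ * hk
  · simpa [hs] using hasDerivAt_const φ (0 : ℝ)

end Poles

lemma cross_cross_of_unit {N v : Fin 3 → ℝ} (hN : N ⬝ᵥ N = 1) (hv : N ⬝ᵥ v = 0) :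
    N ⨯₃ (N ⨯₃ v) = -v := by
  rw [cross_cross_eq_smul_sub_smul', hv, hN, zero_smul, zero_sub, one_smul]

/-- The conformal (`ε = 1`) or anticonformal (`ε = -1`) part of the linear map that sends one
orthonormal pair of the tangent plane of the sphere to the pair `U`, `V` orthogonal to `N`. -/
def conformalPart (ε : ℝ) (N U V : Fin 3 → ℝ) : Fin 3 → ℝ := U - ε • (N ⨯₃ V)

section ConformalPart

variable {ε : ℝ} {N U V : Fin 3 → ℝ}

lemma dotProduct_conformalPart_normal (hU : N ⬝ᵥ U = 0) :
    N ⬝ᵥ conformalPart ε N U V = 0 := by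
  rw [conformalPart, dotProduct_sub, dotProduct_smul, dot_self_cross, hU]
  simp

lemma conformalPart_dotProduct_self_pos (hε : ε ^ 2 = 1) (hN : N ⬝ᵥ N = 1)
    (hV : N ⬝ᵥ V = 0) (h : 0 < ε * triple N U V) :
    0 < conformalPart ε N U V ⬝ᵥ conformalPart ε N U V := by
  have e : conformalPart ε N U V ⬝ᵥ conformalPart ε N U V =
      U ⬝ᵥ U + 2 * (ε * triple N U V) + ε ^ 2 * ((N ⬝ᵥ N) * (V ⬝ᵥ V) - (N ⬝ᵥ V) ^ 2) := by
    simp only [conformalPart, triple, dotProduct, Fin.sum_univ_three, cross_apply]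
    simp
    ring
  have hU0 : 0 ≤ U ⬝ᵥ U := Finset.sum_nonneg fun i _ => mul_self_nonneg _
  have hV0 : 0 ≤ V ⬝ᵥ V := Finset.sum_nonneg fun i _ => mul_self_nonneg _
  rw [e, hε, hN, hV]
  linarith

end ConformalPart

/-- Let `N` be a map from the sphere to the unit sphere, covered by linear isomorphisms `A p` from
the tangent planes of the domain to those of the target. Then the degree of `N` is the sign `ε` of
the orientation of `A`; here `D` is the Jacobian of `N`. -/
lemma integral_jacobian_gaussMap {N : E3 → Fin 3 → ℝ} {A : E3 → E3 →L[ℝ] (Fin 3 → ℝ)}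
    (hNs : ∀ y, y ≠ 0 → ContDiffAt ℝ ∞ N y) (hAs : ∀ y, y ≠ 0 → ContDiffAt ℝ ∞ A y)
    (hNN : ∀ p : Sph, N p ⬝ᵥ N p = 1) (hAN : ∀ p : Sph, A p p = N p)
    (hAt : ∀ (p : Sph) (v : E3), inner ℝ (p : E3) v = 0 → N p ⬝ᵥ A p v = 0)
    {ε : ℝ} (hε : ε ^ 2 = 1) (hdet : ∀ p : Sph, 0 < ε * det3 (A p))
    {D : Sph → ℝ} (hD : Continuous D)
    (hDN : ∀ (p : Sph) (v w : E3), inner ℝ (p : E3) v = 0 → inner ℝ (p : E3) w = 0 →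
      D p * triple (p : E3) v w = triple (N p) (fderiv ℝ N p v) (fderiv ℝ N p w)) :
    ∫ p, D p ∂roundMeasure = 4 * π * ε := by
  have hne : ∀ q, spherePt q ≠ 0 := fun q => (sphereChart q).ne_zero
  set M : ℝ × ℝ → Fin 3 → ℝ := fun q => N (spherePt q) with hM
  set U : ℝ × ℝ → Fin 3 → ℝ := fun q => A (spherePt q) (eTheta q) with hU
  set V : ℝ × ℝ → Fin 3 → ℝ := fun q => A (spherePt q) (ePhi q) with hV
  have hMs : ContDiff ℝ ∞ M := contDiff_iff_contDiffAt.2 fun q =>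
    (hNs _ (hne q)).comp q contDiff_spherePt.contDiffAt
  have hAq : ContDiff ℝ ∞ fun q => A (spherePt q) := contDiff_iff_contDiffAt.2 fun q =>
    (hAs _ (hne q)).comp q contDiff_spherePt.contDiffAt
  have hUs : ContDiff ℝ ∞ U := hAq.clm_apply contDiff_eTheta
  have hVs : ContDiff ℝ ∞ V := hAq.clm_apply contDiff_ePhi
  have hMM : ∀ q, M q ⬝ᵥ M q = 1 := fun q => hNN (sphereChart q)
  have hMU : ∀ q, M q ⬝ᵥ U q = 0 := fun q => hAt (sphereChart q) _ (inner_spherePt_eTheta q)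
  have hMV : ∀ q, M q ⬝ᵥ V q = 0 := fun q => hAt (sphereChart q) _ (inner_spherePt_ePhi q)
  have hUV : ∀ q, 0 < ε * triple (M q) (U q) (V q) := by
    intro q
    have h := triple_map (A (spherePt q)) (spherePt q) (eTheta q) (ePhi q)
    have hAq' : A (spherePt q) (spherePt q) = M q := hAN (sphereChart q)
    rw [triple_spherePt_eTheta_ePhi, mul_one, hAq'] at h
    rw [h]
    exact hdet (sphereChart q)
  set a : ℝ × ℝ → Fin 3 → ℝ := fun q => conformalPart ε (M q) (U q) (V q) with ha
  have has : ContDiff ℝ ∞ a := hUs.sub (ContDiff.const_smul ε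
    (contDiff_iff_contDiffAt.2 fun q => contDiffAt_crossProduct hMs.contDiffAt hVs.contDiffAt))
  -- At a pole `N` and `A` are constant, and the frame vector rotates with the coordinate frame.
  have hpole : ∀ c k : ℝ, sin c = 0 → cos c = k → k ^ 2 = 1 → ∀ φ,
      HasDerivAt (fun φ => a (c, φ)) ((k * ε) • (M (c, φ) ⨯₃ a (c, φ))) φ := by
    intro c k hs hc hk φ
    have hM' : ∀ φ, M (c, φ) = M (c, 0) := fun φ => by simp only [hM, spherePt_pole hs φ]
    have hU' : HasDerivAt (fun φ => U (c, φ)) (k • V (c, φ)) φ := by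
      simp only [hU, hV, spherePt_pole hs, ← map_smul]
      exact (A _).hasFDerivAt.comp_hasDerivAt φ (hasDerivAt_eTheta_pole hc φ)
    have hV' : HasDerivAt (fun φ => V (c, φ)) (-k • U (c, φ)) φ := by
      simp only [hU, hV, spherePt_pole hs, ← map_smul]
      exact (A _).hasFDerivAt.comp_hasDerivAt φ (hasDerivAt_ePhi_pole hs hc hk φ)
    have hcr : HasDerivAt (fun φ => M (c, 0) ⨯₃ V (c, φ)) (M (c, 0) ⨯₃ (-k • U (c, φ))) φ :=
      ((crossProduct (M (c, 0))).toContinuousLinearMap).hasFDerivAt.comp_hasDerivAt φ hV'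
    have h := hU'.fun_sub (hcr.const_smul ε)
    have hfun : (fun φ => a (c, φ)) = fun φ => U (c, φ) - ε • (M (c, 0) ⨯₃ V (c, φ)) := by
      ext1 φ
      simp only [ha, conformalPart, hM']
    rw [hfun]
    refine h.congr_deriv ?_
    have hcc := cross_cross_of_unit (hMM (c, φ)) (hMV (c, φ))
    simp only [ha, conformalPart, map_sub, map_smul, hcc, ← hM' φ]
    ext i
    simp only [Pi.smul_apply, Pi.sub_apply, Pi.neg_apply, smul_eq_mul]
    linear_combination -k * V (c, φ) i * hε
  have hGB := integral_area_of_frame hMs has hMM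
    (fun q => conformalPart_dotProduct_self_pos hε (hMM q) (hMV q) (hUV q))
    (fun q => dotProduct_conformalPart_normal (hMU q))
    (fun θ => by simp [hM, spherePt]) (fun θ => by simp [ha, hM, hU, hV, spherePt, eTheta, ePhi])
    (ε := ε)
    (fun φ => by simpa using hpole 0 1 (by simp) (by simp) (by norm_num) φ)
    (fun φ => by simpa using hpole π (-1) (by simp) (by simp) (by norm_num) φ)
  rw [integral_roundMeasure hD, ← hGB]
  refine intervalIntegral.integral_congr fun θ _ => intervalIntegral.integral_congr fun φ _ => ?_
  have hch : ∀ d, fderiv ℝ M (θ, φ) d =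
      fderiv ℝ N (spherePt (θ, φ)) (fderiv ℝ spherePt (θ, φ) d) := fun d => by
    have h := fderiv_comp (θ, φ) ((hNs _ (hne (θ, φ))).differentiableAt (by simp))
      (contDiff_spherePt.differentiable (by simp) (θ, φ))
    exact congrArg (fun L => L d) h
  have hJ := hDN (sphereChart (θ, φ)) _ _ (inner_spherePt_eTheta (θ, φ))
    (inner_spherePt_ePhi (θ, φ))
  have hone : triple (sphereChart (θ, φ) : E3) (eTheta (θ, φ)) (ePhi (θ, φ)) = 1 :=
    triple_spherePt_eTheta_ePhi (θ, φ)
  rw [hone, mul_one] at hJ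
  simp only [hJ, hch, fderiv_spherePt_one_zero, fderiv_spherePt_zero_one, map_smul]
  simp only [triple, Pi.smul_apply, smul_eq_mul]
  simp only [hM, sphereChart]
  ring

/-! ### Cross-sections of the null hypersurface -/

lemma fderiv_eta {G : Type*} [NormedAddCommGroup G] [NormedSpace ℝ G] {u v : G → Mink} {y : G}
    (hu : DifferentiableAt ℝ u y) (hv : DifferentiableAt ℝ v y) (d : G) :
    fderiv ℝ (fun y => eta (u y) (v y)) y d =
      eta (fderiv ℝ u y d) (v y) + eta (u y) (fderiv ℝ v y d) := by
  have hu' := hasFDerivAt_pi'.1 hu.hasFDerivAt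
  have hv' := hasFDerivAt_pi'.1 hv.hasFDerivAt
  have h : HasFDerivAt (fun y => eta (u y) (v y)) _ y :=
    ((((hu' 0).mul (hv' 0)).sub ((hu' 1).mul (hv' 1))).sub ((hu' 2).mul (hv' 2))).sub
      ((hu' 3).mul (hv' 3))
  rw [h.fderiv]
  simp [eta]
  ring

lemma eta_ne_zero_of_null {t m : Mink} (ht : eta t t = 1) (hm : eta m m = 0) (h0 : 0 < m 0) :
    eta t m ≠ 0 := by
  intro h
  obtain ⟨P, hP⟩ := exists_spatial_projection ht
  have hPm : P m = 0 := by
    have := hP m m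
    rw [hm, h] at this
    exact dotProduct_self_eq_zero.1 (by linarith)
  have h1 := hP (Pi.single 0 1) m
  rw [h, hPm, dotProduct_zero] at h1
  simp [eta] at h1
  exact h0.ne' h1

lemma eta_pos_of_null {t m : Mink} (ht : eta t t = 1) (ht0 : 0 < t 0) (hm : eta m m = 0)
    (h0 : 0 < m 0) : 0 < eta t m := by
  have h1 : (t 1 * m 1 + t 2 * m 2 + t 3 * m 3) ^ 2 < (t 0 * m 0) ^ 2 := by
    have hm2 : m 0 ^ 2 = m 1 ^ 2 + m 2 ^ 2 + m 3 ^ 2 := by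
      simp only [eta] at hm; linear_combination hm
    have ht2 : t 0 ^ 2 = 1 + (t 1 ^ 2 + t 2 ^ 2 + t 3 ^ 2) := by
      simp only [eta] at ht; linear_combination ht
    have hpos : 0 < m 0 ^ 2 := by positivity
    have e : (t 0 * m 0) ^ 2 = (t 1 ^ 2 + t 2 ^ 2 + t 3 ^ 2) * (m 1 ^ 2 + m 2 ^ 2 + m 3 ^ 2) +
        m 0 ^ 2 := by
      rw [mul_pow, ht2]; linear_combination (t 1 ^ 2 + t 2 ^ 2 + t 3 ^ 2) * hm2
    rw [e]
    nlinarith [sq_nonneg (t 1 * m 2 - t 2 * m 1), sq_nonneg (t 1 * m 3 - t 3 * m 1),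
      sq_nonneg (t 2 * m 3 - t 3 * m 2)]
  have h2 := (le_abs_self _).trans_lt (abs_lt_of_sq_lt_sq h1 (by positivity))
  simp only [eta]
  linarith

/-- The standing data: a space-like sphere `x` with null normal `l`, a unit time-like vector `t`,
and the projection `P` onto the Euclidean space `t^⊥`. -/
structure IsNullFront (x l : Sph → Mink) (t : Mink) (P : Mink →L[ℝ] (Fin 3 → ℝ)) : Prop where
  sphere : IsSpacelikeSphere x
  normal : IsNullNormal x l
  unit : eta t t = 1
  proj : ∀ u v, eta u v = eta t u * eta t v - P u ⬝ᵥ P v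

/-- The null normal rescaled so that `eta t n = 1`; its affine parameter is `ŝ`. -/
def unitNormal (l : Sph → Mink) (t : Mink) (p : Sph) : Mink := (eta t (l p))⁻¹ • l p

/-- The determinant of the tangent map of the cross-section `ŝ = s`, read in `t^⊥` modulo the
null direction. Its absolute value is the area density. -/
def areaDet (x l : Sph → Mink) (t : Mink) (P : Mink →L[ℝ] (Fin 3 → ℝ)) (s : ℝ) (p : Sph) : ℝ :=
  det3 (frameMap t P (unitNormal l t p) (fderiv ℝ (homExt (crossSection x l t s)) p) p)

/-- The Jacobian of the Gauss map `p ↦ P (n p)` into the unit sphere of `t^⊥`. -/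
def gaussDet (l : Sph → Mink) (t : Mink) (P : Mink →L[ℝ] (Fin 3 → ℝ)) (p : Sph) : ℝ :=
  det3 (frameMap t P (unitNormal l t p) (fderiv ℝ (homExt (unitNormal l t)) p) p)

lemma contDiffAt_det3 {G : Type*} [NormedAddCommGroup G] [NormedSpace ℝ G]
    {A : G → E3 →L[ℝ] (Fin 3 → ℝ)} {y : G} (hA : ContDiffAt ℝ ∞ A y) :
    ContDiffAt ℝ ∞ (fun y => det3 (A y)) y :=
  contDiffAt_triple (hA.clm_apply contDiffAt_const) (hA.clm_apply contDiffAt_const)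
    (hA.clm_apply contDiffAt_const)

lemma contDiffAt_frameMap {t : Mink} {P : Mink →L[ℝ] (Fin 3 → ℝ)} {m F : E3 → Mink} {y : E3}
    (hm : ContDiffAt ℝ ∞ m y) (hF : ContDiffAt ℝ ∞ F y) :
    ContDiffAt ℝ ∞ (fun y => frameMap t P (m y) (fderiv ℝ F y) y) y := by
  have hF' : ContDiffAt ℝ ∞ (fderiv ℝ F) y := hF.fderiv_right (by simp)
  have hPm : ContDiffAt ℝ ∞ (fun y => P (m y)) y := P.contDiff.contDiffAt.comp y hm
  have h1 : ContDiffAt ℝ ∞ (fun y => P ∘L fderiv ℝ F y) y := contDiffAt_const.clm_comp hF'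
  have h2 : ContDiffAt ℝ ∞ (fun y => (etaL t ∘L fderiv ℝ F y).smulRight (P (m y))) y :=
    (contDiffAt_const.clm_comp hF').smulRight hPm
  have h3 : ContDiffAt ℝ ∞ (fun y => (innerSL ℝ y).smulRight (P (m y))) y :=
    (innerSL ℝ).contDiff.contDiffAt.smulRight hPm
  exact (h1.sub h2).add h3

lemma continuous_det3_frameMap {t : Mink} {P : Mink →L[ℝ] (Fin 3 → ℝ)} {m f : Sph → Mink}
    (hm : ∀ y, y ≠ 0 → ContDiffAt ℝ ∞ (homExt m) y)
    (hf : ∀ y, y ≠ 0 → ContDiffAt ℝ ∞ (homExt f) y) :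
    Continuous fun p : Sph => det3 (frameMap t P (m p) (fderiv ℝ (homExt f) p) p) := by
  refine continuous_iff_continuousAt.2 fun p => ?_
  have h := (contDiffAt_det3 (contDiffAt_frameMap (t := t) (P := P) (hm p p.ne_zero)
    (hf p p.ne_zero))).continuousAt
  have h2 : ContinuousAt ((fun y : E3 => det3 (frameMap t P (homExt m y) (fderiv ℝ (homExt f) y) y))
      ∘ fun q : Sph => (q : E3)) p :=
    ContinuousAt.comp h continuous_subtype_val.continuousAt
  refine h2.congr (Filter.Eventually.of_forall fun q => ?_)
  simp [homExt]

namespace IsNullFront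

variable {x l : Sph → Mink} {t : Mink} {P : Mink →L[ℝ] (Fin 3 → ℝ)}

lemma eta_ne_zero (h : IsNullFront x l t P) (p : Sph) : eta t (l p) ≠ 0 :=
  eta_ne_zero_of_null h.unit (h.normal.null p) (h.normal.future p)

lemma eta_unitNormal (h : IsNullFront x l t P) (p : Sph) : eta t (unitNormal l t p) = 1 := by
  rw [unitNormal, eta_smul_right, inv_mul_cancel₀ (h.eta_ne_zero p)]

lemma unitNormal_null (h : IsNullFront x l t P) (p : Sph) :
    eta (unitNormal l t p) (unitNormal l t p) = 0 := by
  rw [unitNormal, eta_smul_right, eta_smul_left, h.normal.null]; simp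

lemma contDiffAt_x (h : IsNullFront x l t P) {y : E3} (hy : y ≠ 0) :
    ContDiffAt ℝ ∞ (homExt x) y := contDiffAt_homExt h.sphere.smooth hy

lemma contDiffAt_l (h : IsNullFront x l t P) {y : E3} (hy : y ≠ 0) :
    ContDiffAt ℝ ∞ (homExt l) y := contDiffAt_homExt h.normal.smooth hy

lemma contDiffAt_inv_eta (h : IsNullFront x l t P) {y : E3} (hy : y ≠ 0) :
    ContDiffAt ℝ ∞ (fun y => (eta t (homExt l y))⁻¹) y :=
  (((etaL t).contDiff.contDiffAt.comp y (h.contDiffAt_l hy)).inv (h.eta_ne_zero _) :)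

lemma contDiffAt_unitNormal (h : IsNullFront x l t P) {y : E3} (hy : y ≠ 0) :
    ContDiffAt ℝ ∞ (homExt (unitNormal l t)) y :=
  (h.contDiffAt_inv_eta hy).smul (h.contDiffAt_l hy)

lemma homExt_crossSection (s : ℝ) : homExt (crossSection x l t s) =
    fun y => homExt x y + s • homExt (unitNormal l t) y := by
  ext1 y
  simp only [homExt, crossSection, generator, unitNormal, smul_smul, div_eq_mul_inv]

lemma contDiffAt_crossSection (h : IsNullFront x l t P) (s : ℝ) {y : E3} (hy : y ≠ 0) :
    ContDiffAt ℝ ∞ (homExt (crossSection x l t s)) y := by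
  rw [homExt_crossSection]
  exact (h.contDiffAt_x hy).add (ContDiffAt.const_smul s (h.contDiffAt_unitNormal hy))

lemma fderiv_crossSection (h : IsNullFront x l t P) (s : ℝ) (p : Sph) (v : E3) :
    fderiv ℝ (homExt (crossSection x l t s)) p v =
      fderiv ℝ (homExt x) p v + s • fderiv ℝ (homExt (unitNormal l t)) p v := by
  have h1 := (h.contDiffAt_x p.ne_zero).differentiableAt (by simp)
  have h2 := (h.contDiffAt_unitNormal p.ne_zero).differentiableAt (by simp)
  have h3 := h1.hasFDerivAt.add (h2.hasFDerivAt.const_smul s)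
  rw [homExt_crossSection]
  exact congrArg (fun L => L v) h3.fderiv

lemma eta_fderiv_unitNormal_self (h : IsNullFront x l t P) (p : Sph) (v : E3) :
    eta (unitNormal l t p) (fderiv ℝ (homExt (unitNormal l t)) p v) = 0 := by
  have hd := (h.contDiffAt_unitNormal p.ne_zero).differentiableAt (by simp)
  have e := fderiv_eta hd hd v
  have hz : (fun y => eta (homExt (unitNormal l t) y) (homExt (unitNormal l t) y)) =
      fun _ => 0 := funext fun y => h.unitNormal_null _
  rw [hz, eta_comm] at e
  simp [homExt] at e
  linarith

lemma eta_t_fderiv_unitNormal (h : IsNullFront x l t P) (p : Sph) (v : E3) :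
    eta t (fderiv ℝ (homExt (unitNormal l t)) p v) = 0 := by
  have hd := (h.contDiffAt_unitNormal p.ne_zero).differentiableAt (by simp)
  have e := ((etaL t).hasFDerivAt.comp (p : E3) hd.hasFDerivAt).fderiv
  have hz : (etaL t) ∘ homExt (unitNormal l t) = fun _ => 1 :=
    funext fun y => h.eta_unitNormal _
  rw [hz] at e
  simpa using (congrArg (fun L => L v) e).symm

lemma eta_unitNormal_deriv_x (h : IsNullFront x l t P) (p : Sph) (v : TangentSpace (𝓡 2) p) :
    eta (unitNormal l t p) (fderiv ℝ (homExt x) p (derivIncl p v)) = 0 := by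
  rw [unitNormal, eta_smul_left,
    ← deriv₂_eq_fderiv ((h.contDiffAt_x p.ne_zero).differentiableAt (by simp)),
    h.normal.normal, mul_zero]

lemma deriv₂_crossSection (h : IsNullFront x l t P) (s : ℝ) (p : Sph)
    (v : TangentSpace (𝓡 2) p) :
    deriv₂ (crossSection x l t s) p v =
      fderiv ℝ (homExt x) p (derivIncl p v) +
        s • fderiv ℝ (homExt (unitNormal l t)) p (derivIncl p v) := by
  rw [deriv₂_eq_fderiv ((h.contDiffAt_crossSection s p.ne_zero).differentiableAt (by simp)),
    h.fderiv_crossSection]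

lemma eta_unitNormal_deriv_crossSection (h : IsNullFront x l t P) (s : ℝ) (p : Sph)
    (v : TangentSpace (𝓡 2) p) :
    eta (unitNormal l t p) (deriv₂ (crossSection x l t s) p v) = 0 := by
  rw [h.deriv₂_crossSection, eta_add_right, eta_smul_right, h.eta_unitNormal_deriv_x,
    h.eta_fderiv_unitNormal_self]
  simp

lemma areaDensity_crossSection (h : IsNullFront x l t P) (s : ℝ) (p : Sph) :
    areaDensity (crossSection x l t s) p = |areaDet x l t P s p| :=
  areaDensity_eq_abs_det3 h.proj (h.unitNormal_null p) (h.eta_unitNormal p)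
    ((h.contDiffAt_crossSection s p.ne_zero).differentiableAt (by simp))
    (h.eta_unitNormal_deriv_crossSection s p)

lemma continuous_areaDet (h : IsNullFront x l t P) (s : ℝ) : Continuous (areaDet x l t P s) :=
  continuous_det3_frameMap (fun _ hy => h.contDiffAt_unitNormal hy)
    (fun _ hy => h.contDiffAt_crossSection s hy)

lemma continuous_gaussDet (h : IsNullFront x l t P) : Continuous (gaussDet l t P) :=
  continuous_det3_frameMap (fun _ hy => h.contDiffAt_unitNormal hy)
    (fun _ hy => h.contDiffAt_unitNormal hy)

lemma crossSection_zero : crossSection x l t 0 = x := by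
  ext1 p
  simp [crossSection, generator]

end IsNullFront

/-! ### The area density as a quadratic polynomial -/

/-- The matrix `eta (e i x) (e j l)` of the null second fundamental form in the frame `e`. -/
def nullForm (x l : Sph → Mink) (e : ∀ p : Sph, Fin 2 → TangentSpace (𝓡 2) p) (p : Sph)
    (i j : Fin 2) : ℝ :=
  eta (deriv₂ x p (e p i)) (deriv₂ l p (e p j))

section SpinCoefficients

variable (x l : Sph → Mink) (e : ∀ p : Sph, Fin 2 → TangentSpace (𝓡 2) p) (p : Sph)

lemma eta_complexVector (a b c d : Mink) :
    eta (complexVector a b) (complexVector c d) =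
      (((eta a c - eta b d) / 2 : ℝ) : ℂ) + ((eta a d + eta b c) / 2 : ℝ) * Complex.I := by
  have h2 : (((√2 : ℝ) : ℂ)) ^ 2 = 2 := by
    rw [← Complex.ofReal_pow, Real.sq_sqrt (by norm_num)]; norm_num
  have h0 : (((√2 : ℝ) : ℂ)) ≠ 0 := by
    rw [Complex.ofReal_ne_zero]; positivity
  simp only [eta, complexVector]
  push_cast
  field_simp
  rw [h2]
  ring_nf
  simp only [Complex.I_sq]
  ring

lemma rho_eq : rho x l e p = (nullForm x l e p 0 0 + nullForm x l e p 1 1) / 2 := by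
  rw [rho, mVec, deltaBarL, eta_complexVector]
  have hneg : ∀ u v : Mink, eta u (-v) = -eta u v := fun u v => by simp [eta]; ring
  simp [nullForm, hneg]

/-- The determinant of the null second fundamental form is at least `ρ² - |σ|²`, with equality
because the form is symmetric; symmetry is not needed for the inequality. -/
lemma rho_sq_sub_sigma_sq_le : rho x l e p ^ 2 - ‖sigma x l e p‖ ^ 2 ≤
    nullForm x l e p 0 0 * nullForm x l e p 1 1 - nullForm x l e p 0 1 * nullForm x l e p 1 0 := by
  rw [rho_eq, sigma, mVec, deltaL, eta_complexVector, Complex.sq_norm, Complex.normSq_add_mul_I]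
  change _ - (((nullForm x l e p 0 0 - nullForm x l e p 1 1) / 2) ^ 2 +
    ((nullForm x l e p 0 1 + nullForm x l e p 1 0) / 2) ^ 2) ≤ _
  nlinarith [sq_nonneg (nullForm x l e p 0 1 - nullForm x l e p 1 0)]

end SpinCoefficients

namespace IsNullFront

variable {x l : Sph → Mink} {t : Mink} {P : Mink →L[ℝ] (Fin 3 → ℝ)}
  {e : ∀ p : Sph, Fin 2 → TangentSpace (𝓡 2) p}

lemma eta_deriv_x_deriv_unitNormal (h : IsNullFront x l t P) (p : Sph) (i j : Fin 2) :
    eta (fderiv ℝ (homExt x) p (derivIncl p (e p i)))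
      (fderiv ℝ (homExt (unitNormal l t)) p (derivIncl p (e p j))) =
      nullForm x l e p i j / eta t (l p) := by
  have hl := (h.contDiffAt_l p.ne_zero).differentiableAt (by simp)
  have hx := (h.contDiffAt_x p.ne_zero).differentiableAt (by simp)
  have hc := (h.contDiffAt_inv_eta p.ne_zero).differentiableAt (by simp)
  have hn : homExt (unitNormal l t) = fun y => (eta t (homExt l y))⁻¹ • homExt l y := rfl
  have h0 : eta (deriv₂ x p (e p i)) (homExt l p) = 0 := by
    rw [eta_comm, homExt, radial_coe]; exact h.normal.normal p _
  rw [hn, fderiv_fun_smul hc hl, ← deriv₂_eq_fderiv hx]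
  simp only [_root_.add_apply, _root_.smul_apply, ContinuousLinearMap.smulRight_apply,
    ← deriv₂_eq_fderiv hl, eta_add_right, eta_smul_right, h0]
  rw [homExt, radial_coe, nullForm]
  ring

/-- The tangent vectors of the cross-section `ŝ = 0` along an orthonormal frame, and their rates
of change with `ŝ`, in the Euclidean plane orthogonal to `P n`: the properties that all pointwise
computations use. -/
lemma exists_frame (h : IsNullFront x l t P) (he : IsOrthonormalFrame x e) (p : Sph) :
    ∃ u c : Fin 2 → Fin 3 → ℝ,
      (∀ i j, u i ⬝ᵥ u j = if i = j then 1 else 0) ∧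
      (∀ i, u i ⬝ᵥ P (unitNormal l t p) = 0) ∧ (∀ i, c i ⬝ᵥ P (unitNormal l t p) = 0) ∧
      (∀ i j, u i ⬝ᵥ c j = -(nullForm x l e p i j / eta t (l p))) ∧
      (∀ s i j, -eta (deriv₂ (crossSection x l t s) p (e p i))
        (deriv₂ (crossSection x l t s) p (e p j)) = (u i + s • c i) ⬝ᵥ (u j + s • c j)) ∧
      (∀ s, areaDet x l t P s p *
        triple (p : E3) (derivIncl p (e p 0)) (derivIncl p (e p 1)) =
          triple (P (unitNormal l t p)) (u 0 + s • c 0) (u 1 + s • c 1)) ∧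
      gaussDet l t P p * triple (p : E3) (derivIncl p (e p 0)) (derivIncl p (e p 1)) =
        triple (P (unitNormal l t p)) (c 0) (c 1) := by
  set n := unitNormal l t p with hn
  have hx := (h.contDiffAt_x p.ne_zero).differentiableAt (by simp)
  have hnd := (h.contDiffAt_unitNormal p.ne_zero).differentiableAt (by simp)
  have hnull := h.unitNormal_null p
  have htn := h.eta_unitNormal p
  have hxn := fun i => h.eta_unitNormal_deriv_x p (e p i)
  have hnn := fun i => h.eta_fderiv_unitNormal_self p (derivIncl p (e p i))
  refine ⟨fun i => shadow t P n (fderiv ℝ (homExt x) p (derivIncl p (e p i))),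
    fun i => shadow t P n (fderiv ℝ (homExt (unitNormal l t)) p (derivIncl p (e p i))),
    fun i j => ?_, fun i => shadow_dotProduct_normal h.proj hnull htn (hxn i),
    fun i => shadow_dotProduct_normal h.proj hnull htn (hnn i), fun i j => ?_,
    fun s i j => ?_, fun s => ?_, ?_⟩
  · rw [shadow_dotProduct_shadow h.proj hnull htn (hxn i) (hxn j), ← deriv₂_eq_fderiv hx,
      ← deriv₂_eq_fderiv hx, he p i j]
    split_ifs <;> norm_num
  · rw [shadow_dotProduct_shadow h.proj hnull htn (hxn i) (hnn j),
      h.eta_deriv_x_deriv_unitNormal]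
  · rw [← shadow_dotProduct_shadow h.proj hnull htn
        (h.eta_unitNormal_deriv_crossSection s p _) (h.eta_unitNormal_deriv_crossSection s p _),
      h.deriv₂_crossSection, h.deriv₂_crossSection, map_add, map_add, map_smul, map_smul]
  · rw [areaDet, det3_frameMap_mul (fderiv_homExt_radial
      ((h.contDiffAt_crossSection s p.ne_zero).differentiableAt (by simp)))
      (derivIncl_orthogonal p _) (derivIncl_orthogonal p _), h.fderiv_crossSection,
      h.fderiv_crossSection, map_add, map_add, map_smul, map_smul]
  · rw [gaussDet, det3_frameMap_mul (fderiv_homExt_radial hnd)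
      (derivIncl_orthogonal p _) (derivIncl_orthogonal p _)]

lemma areaDet_zero_ne_zero (h : IsNullFront x l t P) (he : IsOrthonormalFrame x e) (p : Sph) :
    areaDet x l t P 0 p ≠ 0 := by
  obtain ⟨u, c, huu, hu, -, -, -, hD, -⟩ := h.exists_frame he p
  intro h0
  have hN := projection_unit h.proj (h.unitNormal_null p) (h.eta_unitNormal p)
  have h1 := triple_sq_of_unit_normal hN (hu 0) (hu 1)
  have h2 := hD 0
  simp only [h0, zero_mul, zero_smul, add_zero] at h2
  rw [← h2, huu, huu, huu, huu] at h1
  norm_num at h1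

lemma triple_derivIncl_ne_zero (h : IsNullFront x l t P) (he : IsOrthonormalFrame x e)
    (p : Sph) : triple (p : E3) (derivIncl p (e p 0)) (derivIncl p (e p 1)) ≠ 0 := by
  obtain ⟨u, c, huu, hu, -, -, -, hD, -⟩ := h.exists_frame he p
  intro h0
  have hN := projection_unit h.proj (h.unitNormal_null p) (h.eta_unitNormal p)
  have h1 := triple_sq_of_unit_normal hN (hu 0) (hu 1)
  have h2 := hD 0
  simp only [h0, mul_zero, zero_smul, add_zero] at h2
  rw [← h2, huu, huu, huu, huu] at h1
  norm_num at h1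

/-- The Gauss–Kronecker curvature of the null second fundamental form is the ratio of the
Jacobian of the Gauss map to the area density. -/
lemma gaussDet_eq (h : IsNullFront x l t P) (he : IsOrthonormalFrame x e) (p : Sph) :
    gaussDet l t P p = areaDet x l t P 0 p *
      ((nullForm x l e p 0 0 * nullForm x l e p 1 1 -
        nullForm x l e p 0 1 * nullForm x l e p 1 0) / eta t (l p) ^ 2) := by
  obtain ⟨u, c, huu, hu, hc, huc, -, hD, hG⟩ := h.exists_frame he p
  have hN := projection_unit h.proj (h.unitNormal_null p) (h.eta_unitNormal p)
  have h1 := triple_det hN (hu 0) (hu 1) (hc 0) (hc 1) (by simp [huu]) (by simp [huu])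
    (by simp [huu])
  have h0 := hD 0
  simp only [zero_smul, add_zero] at h0
  refine mul_right_cancel₀ (h.triple_derivIncl_ne_zero he p) ?_
  rw [hG, h1, ← h0]
  simp only [huc]
  have := h.eta_ne_zero p
  field_simp

/-- The Steiner polynomial of the area density. -/
lemma areaDet_eq (h : IsNullFront x l t P) (he : IsOrthonormalFrame x e) (s : ℝ) (p : Sph) :
    areaDet x l t P s p = areaDet x l t P 0 p +
      s * (areaDet x l t P 0 p * (-2 * (rho x l e p / eta t (l p)))) +
        s ^ 2 * gaussDet l t P p := by
  obtain ⟨u, c, huu, hu, hc, huc, -, hD, hG⟩ := h.exists_frame he p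
  have hN := projection_unit h.proj (h.unitNormal_null p) (h.eta_unitNormal p)
  have h1 := triple_trace hN (hu 0) (hu 1) (hc 0) (hc 1) (by simp [huu]) (by simp [huu])
    (by simp [huu])
  have h0 := hD 0
  simp only [zero_smul, add_zero] at h0
  refine mul_right_cancel₀ (h.triple_derivIncl_ne_zero he p) ?_
  rw [hD, triple_add_smul, h1, ← hG, ← h0, rho_eq]
  simp only [huc]
  ring

/-- Where the cross-section is a space-like immersion, its area density does not vanish. -/
lemma areaDet_ne_zero (h : IsNullFront x l t P) (he : IsOrthonormalFrame x e) {s : ℝ}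
    (hs : IsSpacelike (crossSection x l t s)) (p : Sph) : areaDet x l t P s p ≠ 0 := by
  obtain ⟨u, c, huu, hu, hc, -, hg, hD, -⟩ := h.exists_frame he p
  intro h0
  have hN := projection_unit h.proj (h.unitNormal_null p) (h.eta_unitNormal p)
  have hw : ∀ i, (u i + s • c i) ⬝ᵥ P (unitNormal l t p) = 0 := fun i => by
    rw [add_dotProduct, smul_dotProduct, hu, hc]; simp
  have h1 := triple_sq_of_unit_normal hN (hw 0) (hw 1)
  rw [← hD, h0] at h1
  simp only [← hg] at h1
  have hindep : ∀ a b : ℝ, a • e p 0 + b • e p 1 = 0 → a = 0 ∧ b = 0 := by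
    intro a b hab
    have hx := congrArg (deriv₂ x p) hab
    rw [map_add, map_smul, map_smul, map_zero] at hx
    have key : ∀ i, a * eta (deriv₂ x p (e p i)) (deriv₂ x p (e p 0)) +
        b * eta (deriv₂ x p (e p i)) (deriv₂ x p (e p 1)) = 0 := fun i => by
      rw [← eta_smul_right, ← eta_smul_right, ← eta_add_right, hx]; simp [eta]
    have k0 := key 0
    have k1 := key 1
    simp only [he p] at k0 k1
    norm_num at k0 k1
    exact ⟨k0, k1⟩
  set g₀₀ := eta (deriv₂ (crossSection x l t s) p (e p 0))
    (deriv₂ (crossSection x l t s) p (e p 0))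
  set g₀₁ := eta (deriv₂ (crossSection x l t s) p (e p 0))
    (deriv₂ (crossSection x l t s) p (e p 1))
  have hcomm : eta (deriv₂ (crossSection x l t s) p (e p 1))
      (deriv₂ (crossSection x l t s) p (e p 0)) = g₀₁ := eta_comm _ _
  rw [zero_mul, hcomm] at h1
  -- If the Gram determinant vanishes, this tangent vector has norm zero.
  have hv : -g₀₁ • e p 0 + g₀₀ • e p 1 = 0 := by
    by_contra hne
    have := hs p _ hne
    rw [map_add, map_smul, map_smul, eta_add_left, eta_add_right, eta_add_right] at this
    simp only [eta_smul_left, eta_smul_right] at this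
    rw [hcomm] at this
    refine this.ne ?_
    linear_combination -g₀₀ * h1
  have hg0 := (hindep _ _ hv).2
  have he0 : e p 0 ≠ 0 := by
    intro hz
    have := (hindep 1 0 (by rw [hz]; simp)).1
    norm_num at this
  exact (hs p _ he0).ne hg0

/-- The orientation of the tangent map of `S`, read in `t^⊥`, is the same everywhere. -/
lemma exists_orientation (h : IsNullFront x l t P) (he : IsOrthonormalFrame x e) :
    ∃ ε : ℝ, ε ^ 2 = 1 ∧ ∀ p, 0 < ε * areaDet x l t P 0 p := by
  have hconn : IsPreconnected (univ : Set Sph) := by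
    have := Subtype.preconnectedSpace (isPreconnected_sphere (E := E3)
      (by rw [← Module.finrank_eq_rank, finrank_euclideanSpace_fin]; norm_num) 0 1)
    exact isPreconnected_univ
  by_cases hpos : ∀ p, 0 < areaDet x l t P 0 p
  · exact ⟨1, by norm_num, fun p => by simpa using hpos p⟩
  · obtain ⟨p₀, hp₀⟩ := not_forall.1 hpos
    refine ⟨-1, by norm_num, fun p => ?_⟩
    by_contra hp
    obtain ⟨q, -, hq⟩ := hconn.intermediate_value (mem_univ p₀) (mem_univ p)
      (h.continuous_areaDet 0).continuousOn ⟨not_lt.1 hp₀, by linarith⟩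
    exact h.areaDet_zero_ne_zero he q hq

/-- The Gauss–Bonnet theorem for the pulled-back connection: the Gauss map has degree `±1`. -/
lemma integral_gaussDet (h : IsNullFront x l t P) {ε : ℝ} (hε : ε ^ 2 = 1)
    (hdet : ∀ p, 0 < ε * areaDet x l t P 0 p) :
    ∫ p, gaussDet l t P p ∂roundMeasure = 4 * π * ε := by
  have hnd := fun p : Sph => (h.contDiffAt_unitNormal p.ne_zero).differentiableAt
    (n := ∞) (by simp)
  have hxd := fun p : Sph => (h.contDiffAt_x p.ne_zero).differentiableAt (n := ∞) (by simp)
  refine integral_jacobian_gaussMap (N := fun y => P (homExt (unitNormal l t) y))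
    (A := fun y => frameMap t P (homExt (unitNormal l t) y) (fderiv ℝ (homExt x) y) y)
    (fun y hy => P.contDiff.contDiffAt.comp y (h.contDiffAt_unitNormal hy))
    (fun y hy => contDiffAt_frameMap (h.contDiffAt_unitNormal hy) (h.contDiffAt_x hy))
    (fun p => projection_unit h.proj (h.unitNormal_null _) (h.eta_unitNormal _))
    (fun p => frameMap_self (fderiv_homExt_radial (hxd p))) (fun p v hv => ?_) hε (fun p => ?_)
    h.continuous_gaussDet (fun p v w hv hw => ?_)
  · obtain ⟨v', rfl⟩ := exists_derivIncl_eq hv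
    simp only [homExt, radial_coe]
    rw [dotProduct_comm, frameMap_of_orthogonal _ hv]
    exact shadow_dotProduct_normal h.proj (h.unitNormal_null p) (h.eta_unitNormal p)
      (h.eta_unitNormal_deriv_x p v')
  · have := hdet p
    rw [areaDet, crossSection_zero] at this
    simpa only [homExt, radial_coe] using this
  · have hP : ∀ d, fderiv ℝ (fun y => P (homExt (unitNormal l t) y)) p d =
        P (fderiv ℝ (homExt (unitNormal l t)) p d) := fun d => by
      have h1 := (P.hasFDerivAt.comp (p : E3) (hnd p).hasFDerivAt).fderiv
      exact congrArg (fun L => L d) h1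
    rw [gaussDet, det3_frameMap_mul (fderiv_homExt_radial (hnd p)) hv hw, hP, hP,
      shadow_apply, shadow_apply, h.eta_t_fderiv_unitNormal, h.eta_t_fderiv_unitNormal]
    simp [homExt]

/-- The Steiner formula, provided that the orientation of the cross-section agrees with that of
`S` or degenerates. -/
lemma area_crossSection (h : IsNullFront x l t P) (he : IsOrthonormalFrame x e) {s : ℝ}
    (hs : ∀ p, 0 ≤ areaDet x l t P 0 p * areaDet x l t P s p) :
    area (crossSection x l t s) = area x + 2 * s * mHat x l e t + 4 * π * s ^ 2 := by
  obtain ⟨ε, hε, hdet⟩ := h.exists_orientation he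
  have habs : ∀ s, (∀ p, 0 ≤ areaDet x l t P 0 p * areaDet x l t P s p) → ∀ p,
      areaDensity (crossSection x l t s) p = ε * areaDet x l t P s p := by
    intro s hs p
    have h1 : 0 ≤ ε * areaDet x l t P s p := by
      refine nonneg_of_mul_nonneg_right (a := ε * areaDet x l t P 0 p) ?_ (hdet p)
      refine (hs p).trans_eq ?_
      linear_combination -areaDet x l t P 0 p * areaDet x l t P s p * hε
    have h2 : |ε| = 1 := by rw [← sq_eq_sq₀ (abs_nonneg _) zero_le_one, sq_abs, hε, one_pow]
    rw [h.areaDensity_crossSection, ← abs_of_nonneg h1, abs_mul, h2, one_mul]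
  have habs0 : ∀ p, areaDensity x p = ε * areaDet x l t P 0 p := fun p => by
    have := habs 0 (fun p => mul_self_nonneg _) p
    rwa [crossSection_zero] at this
  set τ : Sph → ℝ := fun p => areaDet x l t P 0 p * (-2 * (rho x l e p / eta t (l p))) with hτ
  have hτc : Continuous τ := by
    have : τ = fun p => areaDet x l t P 1 p - areaDet x l t P 0 p - gaussDet l t P p := by
      ext1 p
      rw [h.areaDet_eq he 1 p]
      ring
    rw [this]
    exact ((h.continuous_areaDet 1).sub (h.continuous_areaDet 0)).sub h.continuous_gaussDet
  have hI0 := integrable_of_continuous (h.continuous_areaDet 0)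
  have hI1 := integrable_of_continuous hτc
  have hI2 := integrable_of_continuous h.continuous_gaussDet
  have hM : 2 * mHat x l e t = ε * ∫ p, τ p ∂roundMeasure := by
    rw [mHat, surfaceIntegral, ← integral_const_mul, ← integral_neg, ← integral_const_mul]
    refine integral_congr_ae (Filter.Eventually.of_forall fun p => ?_)
    simp only [habs0, hτ]
    ring
  have hA0 : area x = ε * ∫ p, areaDet x l t P 0 p ∂roundMeasure := by
    rw [area, surfaceIntegral, ← integral_const_mul]
    simp only [one_mul, habs0]
  have hAs : area (crossSection x l t s) = ε * ∫ p, (areaDet x l t P 0 p + s * τ p +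
      s ^ 2 * gaussDet l t P p) ∂roundMeasure := by
    rw [area, surfaceIntegral, ← integral_const_mul]
    simp only [one_mul, habs s hs, hτ, ← h.areaDet_eq he]
  have hsum := integral_add (hI0.add (hI1.const_mul s)) (hI2.const_mul (s ^ 2))
  simp only [Pi.add_apply] at hsum
  rw [hAs, hA0, hsum, integral_add hI0 (hI1.const_mul s), integral_const_mul,
    integral_const_mul, h.integral_gaussDet hε hdet]
  linear_combination -s * hM + 4 * π * s ^ 2 * hε

end IsNullFront

end Minkowski

end

open Minkowski in
theorem proposition4p5
    (x l : Sph → Mink) (hx : IsSpacelikeSphere x) (hl : IsNullNormal x l)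
    (e : ∀ p : Sph, Fin 2 → TangentSpace (𝓡 2) p) (he : IsOrthonormalFrame x e)
    (t : Mink) (ht : eta t t = 1) :
    -- before the first caustic, in either direction along the null hypersurface
    (∀ shat : ℝ, (∀ τ ∈ Set.uIoo 0 shat, IsSpacelike (crossSection x l t τ)) →
      area (crossSection x l t shat) =
        area x + 2 * shat * mHat x l e t + 4 * Real.pi * shat ^ 2) ∧
    -- for a future convex surface, all the way to the future
    (FutureConvex x l e → 0 < t 0 → ∀ shat : ℝ, 0 ≤ shat →
      area (crossSection x l t shat) =
        area x + 2 * shat * mHat x l e t + 4 * Real.pi * shat ^ 2) := by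
  obtain ⟨P, hP⟩ := exists_spatial_projection ht
  have h : IsNullFront x l t P := ⟨hx, hl, ht, hP⟩
  refine ⟨fun s hs => h.area_crossSection he fun p => ?_,
    fun hconv ht0 s hs => h.area_crossSection he fun p => ?_⟩
  · -- The density has no zero strictly between `0` and `s`, so it does not change sign.
    by_contra hneg
    set g : ℝ → ℝ := fun τ => areaDet x l t P 0 p * areaDet x l t P τ p with hg
    have hgc : Continuous g := by
      have : g = fun τ => areaDet x l t P 0 p * (areaDet x l t P 0 p +
          τ * (areaDet x l t P 0 p * (-2 * (rho x l e p / eta t (l p)))) +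
            τ ^ 2 * gaussDet l t P p) := by
        ext1 τ
        rw [hg, ← h.areaDet_eq he]
      rw [this]
      fun_prop
    have hg0 : 0 < g 0 := mul_self_pos.2 (h.areaDet_zero_ne_zero he p)
    have hgs : g s < 0 := not_le.1 hneg
    obtain ⟨τ, hτ, hτ0⟩ := intermediate_value_uIcc (a := 0) (b := s) hgc.continuousOn
      (Set.mem_uIcc_of_ge hgs.le hg0.le)
    have hne0 : τ ≠ 0 := fun hz => by rw [hz] at hτ0; exact hg0.ne' hτ0
    have hnes : τ ≠ s := fun hz => by rw [hz] at hτ0; exact hgs.ne hτ0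
    have hmem : τ ∈ Set.uIoo 0 s := by
      rcases le_total 0 s with h0 | h0
      · rw [Set.uIcc_of_le h0] at hτ
        rw [Set.uIoo_of_le h0]
        exact ⟨lt_of_le_of_ne hτ.1 hne0.symm, lt_of_le_of_ne hτ.2 hnes⟩
      · rw [Set.uIcc_of_ge h0] at hτ
        rw [Set.uIoo_of_ge h0]
        exact ⟨lt_of_le_of_ne hτ.1 hnes.symm, lt_of_le_of_ne hτ.2 hne0⟩
    exact mul_ne_zero (h.areaDet_zero_ne_zero he p) (h.areaDet_ne_zero he (hs τ hmem) p) hτ0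
  · -- All coefficients of the Steiner polynomial have the sign of the constant term.
    have hl0 : 0 < eta t (l p) := eta_pos_of_null ht ht0 (hl.null p) (hl.future p)
    have h1 : 0 ≤ -2 * (rho x l e p / eta t (l p)) := by
      have := div_neg_of_neg_of_pos (hconv p).1 hl0
      linarith
    have h2 := div_nonneg ((hconv p).2.le.trans (rho_sq_sub_sigma_sq_le x l e p))
      (sq_nonneg (eta t (l p)))
    rw [h.areaDet_eq he s, h.gaussDet_eq he]
    set k := (nullForm x l e p 0 0 * nullForm x l e p 1 1 -
        nullForm x l e p 0 1 * nullForm x l e p 1 0) / eta t (l p) ^ 2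
    have e' : areaDet x l t P 0 p * (areaDet x l t P 0 p +
        s * (areaDet x l t P 0 p * (-2 * (rho x l e p / eta t (l p)))) +
          s ^ 2 * (areaDet x l t P 0 p * k)) =
        areaDet x l t P 0 p ^ 2 * (1 + s * (-2 * (rho x l e p / eta t (l p))) + s ^ 2 * k) := by
      ring
    rw [e']
    positivity
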